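/- Let $L_{1,1}(\mathbb R_+)$, $\mathbb R_+=(0,\infty)$, be the set of real-valued measurable functions $q$ with $\int_0^\infty (1+x)|q(x)|\,dx<\infty$ (functions equal almost everywhere are identified). For $q\in L_{1,1}(\mathbb R_+)$ and $k\in\mathbb C$ with $\operatorname{Im}k\ge 0$ let $f(x,k)$, $x\ge 0$, be the Jost solution, i.e. the solution of $$u''+k^2u-q(x)u=0,\quad x>0,\qquad\text{with}\qquad f(x,k)=e^{ikx}(1+o(1))\ \text{ as } x\to+\infty$$ (solutions are understood to have a locally absolutely continuous first derivative on $[0,\infty)$ and to satisfy the equation almost everywhere). Put $f(k):=f(0,k)$ and let $$I(k):=\frac{f'(0,k)}{f(k)}$$ be the I-function, where $'$ is the derivative in $x$. (i) For every $q\in L_{1,1}(\mathbb R_+)$ and every $k$ with $\operatorname{Im}k>0$ and $f(k)\ne 0$, the I-function equals the Weyl function: $m=I(k)$ is the one and only complex number $m$ for which the solution $W$ of the equation with $W(0)=1$, $W'(0)=m$ belongs to $L^2(\mathbb R_+)$. (ii) The values of $I(k)$ for all $k>0$ determine $q$ uniquely: if $q_1,q_2\in L_{1,1}(\mathbb R_+)$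 have I-functions $I_1,I_2$ with $I_1(k)=I_2(k)$ for all $k>0$, then $q_1=q_2$ almost everywhere on $\mathbb R_+$. -/

import Mathlib

open MeasureTheory Filter Topology

noncomputable section

/-- The class `L_{1,1}(ℝ₊)` of real-valued potentials: `q` is (a.e.-)measurable on `(0,∞)` and
`∫₀^∞ (1 + x) |q x| dx < ∞`. Only the values of `q` on `(0,∞)` matter. -/
def MemL11 (q : ℝ → ℝ) : Prop :=
  IntegrableOn (fun x : ℝ => (1 + x) * q x) (Set.Ioi 0)

/-- The derivative `u'` on the closed half-axis `[0,∞)`; at `x = 0` it is the right derivative. -/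
def halfDeriv (u : ℝ → ℂ) (x : ℝ) : ℂ :=
  derivWithin u (Set.Ici 0) x

/-- `u` solves `u'' + k² u - q u = 0` on the half-axis `[0,∞)` in the usual (Carathéodory) sense
for an integrable potential: `u` is differentiable, `u'` is locally absolutely continuous and
`u'' = (q - k²) u` almost everywhere, i.e. `u'` is the integral of `(q - k²) u`. -/
structure IsSolution (q : ℝ → ℝ) (k : ℂ) (u : ℝ → ℂ) : Prop where
  differentiableOn : DifferentiableOn ℝ u (Set.Ici 0)
  halfDeriv_eq : ∀ x : ℝ, 0 ≤ x →
    halfDeriv u x = halfDeriv u 0 + ∫ t in (0 : ℝ)..x, ((q t : ℂ) - k ^ 2) * u t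

/-- `u` is the Jost solution: it solves the equation on `[0,∞)` and
`u x = e^{ikx} (1 + o(1))` as `x → +∞`. For real `k` this says `u x = e^{ikx} + o(1)`; for
`Im k > 0` it is the normalization that singles out one solution. -/
structure IsJostSolution (q : ℝ → ℝ) (k : ℂ) (u : ℝ → ℂ) : Prop where
  isSolution : IsSolution q k u
  asymptotics : Tendsto (fun x : ℝ => Complex.exp (-(Complex.I * k * x)) * u x) atTop (𝓝 1)

open Classical in
/-- The Jost solution `x ↦ f(x,k)`. For `q ∈ L_{1,1}(ℝ₊)` and `Im k ≥ 0` there is exactly one on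
`[0,∞)`; the values at `x < 0` are irrelevant. -/
def jostSolution (q : ℝ → ℝ) (k : ℂ) : ℝ → ℂ :=
  if h : ∃ u : ℝ → ℂ, IsJostSolution q k u then h.choose else 0

/-- The Jost function `f(k) = f(0,k)`. -/
def jostFunction (q : ℝ → ℝ) (k : ℂ) : ℂ :=
  jostSolution q k 0

/-- The I-function `I(k) = f'(0,k) / f(k)`. -/
def iFunction (q : ℝ → ℝ) (k : ℂ) : ℂ :=
  halfDeriv (jostSolution q k) 0 / jostFunction q k

/-- `m` is a value of the Weyl function at `k`: the solution `W = ψ + m φ`, that is, the solution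
with `W(0) = 1` and `W'(0) = m`, belongs to `L²(ℝ₊)`. (Here `φ`, `ψ` are the solutions with
`φ(0) = 0`, `φ'(0) = 1`, `ψ(0) = 1`, `ψ'(0) = 0`.) -/
def IsWeylValue (q : ℝ → ℝ) (k m : ℂ) : Prop :=
  ∃ W : ℝ → ℂ, IsSolution q k W ∧ W 0 = 1 ∧ halfDeriv W 0 = m ∧
    MemLp W 2 (volume.restrict (Set.Ioi 0))

end

/-!
The equation is solved by one Volterra series. For an integrable potential `Q` on the line with
`∫₀^∞ s |Q s| ds < ∞`, the Jost solution at `+∞` is `e^{iky} h(y)` (`lineJost`), where `h` is the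
sum of the series for `h(y) = 1 + ∫_y^∞ (∫₀^{s-y} e^{2ikτ} dτ) Q(s) h(s) ds` (`jostSeries`). It
converges for `Im k ≥ 0`, and for all `k` when `Q` vanishes on `(0,∞)`. Extending a potential `q` on
`(0,∞)` by zero gives the Jost solution `f(x,k)`, holomorphic in the upper half-plane and continuous
up to the real axis. Reflecting `q` to the negative half-line gives the solutions `e(x,k)` with
`e(0) = 1`, `e'(0) = -ik` (`incoming`), which are entire in `k` and bounded by `C(x) e^{|Im k| x}`.
For `k ≠ 0` the pair `e(·,±k)` is a fundamental system, which yields uniqueness for the initial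
value problem.

For the first claim, let `W` be a square integrable solution and `w` its Wronskian with `f`. Then
`(W f)' = 2 W f' - w` with `W f` and `W f'` integrable on `(0,∞)`, so `w = 0`, that is
`W'(0) f(0) = W(0) f'(0)` (`MemL11.isWeylValue_iff`). The same identity, with `W` the difference of
two Jost solutions, shows that the Jost solution is unique (`MemL11.eq_lineJost`), hence that
`jostSolution` is the solution constructed here.

The second claim is a theorem of Borg–Marchenko type, proved along the lines of Bennewitz.
* The Wronskian `D(k)` at `0` of the Jost solutions of `q₁` and `q₂` is bounded in the closed upper
  half-plane. It vanishes for `k > 0`, where `f(k) ≠ 0` and the I-functions agree, for `k < 0` by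
  the symmetry `k ↦ -k̄`, and therefore identically by Phragmén–Lindelöf (`crossJost_eq_zero`).
* At a fixed `x`, the function `G(k) = e₁(-k) e₂(k) - e₁(k) e₂(-k)` is entire, odd, of exponential
  type, and bounded on the real axis. As `D = 0`, it is a combination of `f₁ e₂` and `f₂ e₁`
  with bounded coefficients on the far imaginary axis, where the decay of `f` compensates the growth
  of `e`.
  By Phragmén–Lindelöf and Liouville `G` is constant, hence `0` (`crossIncoming_eq_zero`).
* At `k = 1`, differentiating `G = 0` in `x` and using that the two Wronskians are equal gives
  `e₁² = e₂²`. Since `e₂(·,1)` has no zeros, `e₁ = e₂` (`incoming_eq_of_crossIncoming`), and the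
  equation then gives `q₁ = q₂` almost everywhere.
-/

/-! ### Primitives of locally integrable functions -/

/-- `U` is, on `[a,∞)`, a primitive of the locally integrable function `u`. This is local absolute
continuity with the derivative named. -/
structure IsPrimitive (U u : ℝ → ℂ) (a : ℝ) : Prop where
  intervalIntegrable : ∀ b, a ≤ b → IntervalIntegrable u volume a b
  eq_add : ∀ b, a ≤ b → U b = U a + ∫ t in a..b, u t

lemma AbsolutelyContinuousOnInterval.congr {f g : ℝ → ℂ} {a b : ℝ}
    (hf : AbsolutelyContinuousOnInterval f a b) (hfg : Set.EqOn f g (Set.uIcc a b)) :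
    AbsolutelyContinuousOnInterval g a b := by
  rw [absolutelyContinuousOnInterval_iff] at hf ⊢
  intro ε hε
  obtain ⟨δ, hδ, h⟩ := hf ε hε
  refine ⟨δ, hδ, fun E hE hlt => ?_⟩
  convert h E hE hlt using 1
  refine Finset.sum_congr rfl fun i hi => ?_
  rw [hfg (hE.1 i hi).1, hfg (hE.1 i hi).2]

lemma absolutelyContinuousOnInterval_const (c : ℂ) (a b : ℝ) :
    AbsolutelyContinuousOnInterval (fun _ : ℝ => c) a b :=
  (LipschitzWith.const c).lipschitzOnWith.absolutelyContinuousOnInterval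

lemma absolutelyContinuousOnInterval_integral {f : ℝ → ℂ} {a b : ℝ}
    (h : IntervalIntegrable f volume a b) :
    AbsolutelyContinuousOnInterval (fun x ↦ ∫ v in a..x, f v) a b := by
  have hre : IntervalIntegrable (fun t => (f t).re) volume a b := ⟨h.1.re, h.2.re⟩
  have him : IntervalIntegrable (fun t => (f t).im) volume a b := ⟨h.1.im, h.2.im⟩
  have h1 := (hre.absolutelyContinuousOnInterval_intervalIntegral Set.left_mem_uIcc).smul
    (absolutelyContinuousOnInterval_const 1 a b)
  have h2 := (him.absolutelyContinuousOnInterval_intervalIntegral Set.left_mem_uIcc).smul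
    (absolutelyContinuousOnInterval_const Complex.I a b)
  refine (h1.add h2).congr ?_
  intro x hx
  have hx' : IntervalIntegrable f volume a x :=
    h.mono_set (Set.uIcc_subset_uIcc Set.left_mem_uIcc hx)
  have e1 := intervalIntegral.intervalIntegral_re (𝕜 := ℂ) hx'
  have e2 := intervalIntegral.intervalIntegral_im (𝕜 := ℂ) hx'
  simp only [RCLike.re_to_complex, RCLike.im_to_complex] at e1 e2
  simp only [Pi.add_apply, Pi.smul_apply', e1, e2]
  apply Complex.ext <;> simp

namespace IsPrimitive

variable {U V u v : ℝ → ℂ} {a : ℝ}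

lemma intervalIntegrable' (h : IsPrimitive U u a) {b c : ℝ} (hb : a ≤ b) (hc : a ≤ c) :
    IntervalIntegrable u volume b c :=
  (h.intervalIntegrable b hb).symm.trans (h.intervalIntegrable c hc)

lemma sub_eq (h : IsPrimitive U u a) {b c : ℝ} (hb : a ≤ b) (hc : a ≤ c) :
    U c - U b = ∫ t in b..c, u t := by
  rw [h.eq_add c hc, h.eq_add b hb, add_sub_add_left_eq_sub,
    intervalIntegral.integral_interval_sub_left (h.intervalIntegrable c hc)
      (h.intervalIntegrable b hb)]

lemma congr (h : IsPrimitive U u a) (hU : ∀ x, a ≤ x → V x = U x) (hu : ∀ x, a < x → v x = u x) :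
    IsPrimitive V v a where
  intervalIntegrable b hb := by
    refine (h.intervalIntegrable b hb).congr ?_
    intro x hx
    rw [Set.uIoc_of_le hb] at hx
    exact (hu x hx.1).symm
  eq_add b hb := by
    rw [hU b hb, hU a le_rfl, h.eq_add b hb]
    congr 1
    refine intervalIntegral.integral_congr_ae (Eventually.of_forall fun x hx => ?_)
    rw [Set.uIoc_of_le hb] at hx
    exact (hu x hx.1).symm

lemma add (hU : IsPrimitive U u a) (hV : IsPrimitive V v a) :
    IsPrimitive (fun x => U x + V x) (fun x => u x + v x) a where
  intervalIntegrable b hb := (hU.intervalIntegrable b hb).add (hV.intervalIntegrable b hb)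
  eq_add b hb := by
    rw [intervalIntegral.integral_add (hU.intervalIntegrable b hb) (hV.intervalIntegrable b hb),
      hU.eq_add b hb, hV.eq_add b hb]
    ring

lemma const_mul (hU : IsPrimitive U u a) (c : ℂ) :
    IsPrimitive (fun x => c * U x) (fun x => c * u x) a where
  intervalIntegrable b hb := (hU.intervalIntegrable b hb).const_mul c
  eq_add b hb := by
    rw [intervalIntegral.integral_const_mul, hU.eq_add b hb]
    ring

lemma sub (hU : IsPrimitive U u a) (hV : IsPrimitive V v a) :
    IsPrimitive (fun x => U x - V x) (fun x => u x - v x) a :=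
  (hU.add (hV.const_mul (-1))).congr (fun x _ => by ring) (fun x _ => by ring)

lemma const (c : ℂ) : IsPrimitive (fun _ => c) (fun _ => 0) a where
  intervalIntegrable b _ := by simp
  eq_add b _ := by simp

lemma continuousOn (h : IsPrimitive U u a) : ContinuousOn U (Set.Ici a) := by
  intro x hx
  have hx1 : a ≤ x + 1 := by have : a ≤ x := hx; linarith
  have h1 : ContinuousOn (fun y => U a + ∫ t in a..y, u t) (Set.uIcc a (x + 1)) :=
    continuousOn_const.add (intervalIntegral.continuousOn_primitive_interval'
      (h.intervalIntegrable _ hx1) Set.left_mem_uIcc)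
  have h2 : ContinuousOn U (Set.Icc a (x + 1)) := by
    rw [Set.uIcc_of_le hx1] at h1
    exact h1.congr fun y hy => h.eq_add y hy.1
  refine (h2 x ⟨hx, by linarith⟩).mono_of_mem_nhdsWithin ?_
  rw [← Set.Ici_inter_Iic]
  exact inter_mem self_mem_nhdsWithin (mem_nhdsWithin_of_mem_nhds (Iic_mem_nhds (by linarith)))

lemma hasDerivWithinAt (h : IsPrimitive U u a) (hu : ContinuousOn u (Set.Ici a)) {x : ℝ}
    (hx : a ≤ x) : HasDerivWithinAt U (u x) (Set.Ici a) x := by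
  -- extend `u` to a continuous function on the whole line
  set u' : ℝ → ℂ := fun t => u (max a t) with hu'
  have hc : Continuous u' := by
    refine hu.comp_continuous (by fun_prop) fun t => ?_
    simp
  have h1 : HasDerivAt (fun y => U a + ∫ t in a..y, u' t) (u' x) x :=
    (intervalIntegral.integral_hasDerivAt_right (hc.intervalIntegrable _ _)
      (hc.stronglyMeasurableAtFilter _ _) hc.continuousAt).const_add _
  have hux : u' x = u x := by simp [hu', hx]
  rw [hux] at h1
  have key : ∀ y, a ≤ y → U y = U a + ∫ t in a..y, u' t := by
    intro y hy
    rw [h.eq_add y hy]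
    congr 1
    refine intervalIntegral.integral_congr_ae (Eventually.of_forall fun t ht => ?_)
    rw [Set.uIoc_of_le hy] at ht
    simp [hu', ht.1.le]
  exact h1.hasDerivWithinAt.congr key (key x hx)

lemma of_hasDerivAt (hU : ∀ x, HasDerivAt U (u x) x) (hu : Continuous u) : IsPrimitive U u a where
  intervalIntegrable b _ := hu.intervalIntegrable _ _
  eq_add b _ := by
    rw [intervalIntegral.integral_eq_sub_of_hasDerivAt (fun x _ => hU x)
      (hu.intervalIntegrable _ _)]
    ring

lemma of_hasDerivWithinAt (hU : ∀ x, a ≤ x → HasDerivWithinAt U (u x) (Set.Ici a) x)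
    (hu : ContinuousOn u (Set.Ici a)) : IsPrimitive U u a where
  intervalIntegrable b hb := by
    refine ContinuousOn.intervalIntegrable (hu.mono ?_)
    rw [Set.uIcc_of_le hb]
    exact Set.Icc_subset_Ici_self
  eq_add b hb := by
    rw [intervalIntegral.integral_eq_sub_of_hasDeriv_right_of_le (f := U) hb]
    · ring
    · exact fun x hx => ((hU x hx.1).continuousWithinAt).mono Set.Icc_subset_Ici_self
    · intro x hx
      exact (hU x hx.1.le).mono (fun y hy => hx.1.le.trans (le_of_lt hy))
    · refine ContinuousOn.intervalIntegrable (hu.mono ?_)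
      rw [Set.uIcc_of_le hb]
      exact Set.Icc_subset_Ici_self

/-- The product rule for locally absolutely continuous functions. -/
lemma mul (hU : IsPrimitive U u a) (hV : IsPrimitive V v a) :
    IsPrimitive (fun x => U x * V x) (fun x => u x * V x + U x * v x) a := by
  have hint : ∀ b, a ≤ b → IntervalIntegrable (fun x => u x * V x + U x * v x) volume a b := by
    intro b hb
    have hs : Set.uIcc a b ⊆ Set.Ici a := by
      rw [Set.uIcc_of_le hb]; exact Set.Icc_subset_Ici_self
    exact ((hU.intervalIntegrable b hb).mul_continuousOn (hV.continuousOn.mono hs)).add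
      ((hV.intervalIntegrable b hb).continuousOn_mul (hU.continuousOn.mono hs))
  refine ⟨hint, fun b hb => ?_⟩
  set U' : ℝ → ℂ := fun x => U a + ∫ t in a..x, u t with hU'
  set V' : ℝ → ℂ := fun x => V a + ∫ t in a..x, v t with hV'
  have aU : AbsolutelyContinuousOnInterval U' a b :=
    (absolutelyContinuousOnInterval_const (U a) a b).add
      (absolutelyContinuousOnInterval_integral (hU.intervalIntegrable b hb))
  have aV : AbsolutelyContinuousOnInterval V' a b :=
    (absolutelyContinuousOnInterval_const (V a) a b).add
      (absolutelyContinuousOnInterval_integral (hV.intervalIntegrable b hb))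
  have aG := (aU.smul aV).sub (absolutelyContinuousOnInterval_integral (hint b hb))
  obtain ⟨C, hC⟩ := aG.const_of_ae_hasDerivAt_zero (by
    filter_upwards [(hU.intervalIntegrable b hb).ae_hasDerivAt_integral,
      (hV.intervalIntegrable b hb).ae_hasDerivAt_integral,
      (hint b hb).ae_hasDerivAt_integral] with x h1 h2 h3 hx
    have hx' : a ≤ x := by rw [Set.uIcc_of_le hb] at hx; exact hx.1
    have d1 := (h1 hx a Set.left_mem_uIcc).const_add (U a)
    have d2 := (h2 hx a Set.left_mem_uIcc).const_add (V a)
    have d3 := h3 hx a Set.left_mem_uIcc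
    have := (d1.mul d2).sub d3
    rw [← hU.eq_add x hx', ← hV.eq_add x hx', sub_self] at this
    exact this)
  have e1 := hC a Set.left_mem_uIcc
  have e2 := hC b Set.right_mem_uIcc
  simp only [Pi.sub_apply, smul_eq_mul, Pi.mul_apply, hU', hV', ← hU.eq_add b hb, ← hV.eq_add b hb,
    intervalIntegral.integral_same, add_zero, sub_zero] at e1 e2
  rw [← e1] at e2
  linear_combination e2

lemma eq_of_zero (h : IsPrimitive U (fun _ => 0) a) {x : ℝ} (hx : a ≤ x) : U x = U a := by
  simpa using h.eq_add x hx

/-- Reflection of a primitive on the whole line. -/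
lemma reflect (h : ∀ a, IsPrimitive U u a) :
    IsPrimitive (fun x => U (-x)) (fun x => -u (-x)) a where
  intervalIntegrable b hb := by
    have := (h (-b)).intervalIntegrable (-a) (by linarith)
    have h2 := this.comp_sub_left 0
    simp only [zero_sub, neg_neg] at h2
    exact h2.symm.neg
  eq_add b hb := by
    have := (h (-b)).eq_add (-a) (by linarith)
    rw [intervalIntegral.integral_neg, intervalIntegral.integral_comp_neg, this]
    ring

end IsPrimitive

/-! ### Tail integrals and holomorphic dependence of integrals on a parameter -/

section Tail

variable {E : Type*} [NormedAddCommGroup E] [NormedSpace ℝ E] {r : ℝ → E}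

lemma integral_Ioi_eq_add {a b : ℝ} (hr : IntegrableOn r (Set.Ioi a)) (hab : a ≤ b) :
    ∫ t in Set.Ioi a, r t = (∫ t in a..b, r t) + ∫ t in Set.Ioi b, r t := by
  rw [intervalIntegral.integral_of_le hab, ← Set.Ioc_union_Ioi_eq_Ioi hab,
    setIntegral_union (Set.Ioc_disjoint_Ioi le_rfl) measurableSet_Ioi
      (hr.mono_set Set.Ioc_subset_Ioi_self) (hr.mono_set (Set.Ioi_subset_Ioi hab))]

lemma tendsto_integral_Ioi_zero {a : ℝ} (hr : IntegrableOn r (Set.Ioi a)) :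
    Tendsto (fun y => ∫ t in Set.Ioi y, r t) atTop (𝓝 0) := by
  have h1 := intervalIntegral_tendsto_integral_Ioi a hr tendsto_id
  have h2 : Tendsto (fun y => (∫ t in Set.Ioi a, r t) - ∫ t in a..y, r t) atTop (𝓝 0) := by
    simpa using (tendsto_const_nhds (x := ∫ t in Set.Ioi a, r t)).sub h1
  refine h2.congr' ?_
  filter_upwards [eventually_ge_atTop a] with y hy
  rw [integral_Ioi_eq_add hr hy]
  abel

lemma isPrimitive_integral_Ioi {r : ℝ → ℂ} {a : ℝ} (hr : IntegrableOn r (Set.Ioi a)) :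
    IsPrimitive (fun y => ∫ t in Set.Ioi y, r t) (fun t => -r t) a where
  intervalIntegrable b hb := by
    rw [intervalIntegrable_iff, Set.uIoc_of_le hb]
    exact (hr.mono_set Set.Ioc_subset_Ioi_self).neg
  eq_add b hb := by
    rw [intervalIntegral.integral_neg, integral_Ioi_eq_add hr hb]
    abel

lemma antitone_integral_Ioi {r : ℝ → ℝ} (hr : Integrable r) (h0 : ∀ t, 0 ≤ r t) :
    Antitone fun y => ∫ t in Set.Ioi y, r t := by
  intro a b hab
  exact setIntegral_mono_set hr.integrableOn (Eventually.of_forall h0)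
    (Set.Ioi_subset_Ioi hab).eventuallyLE

lemma integrableOn_mul_tail_pow {r : ℝ → ℝ} (hr : Integrable r) (h0 : ∀ t, 0 ≤ r t) (n : ℕ)
    (y : ℝ) : IntegrableOn (fun s => r s * (∫ t in Set.Ioi s, r t) ^ n) (Set.Ioi y) := by
  have hT := antitone_integral_Ioi hr h0
  refine Integrable.mono' (hr.integrableOn.mul_const ((∫ t in Set.Ioi y, r t) ^ n))
    (hr.aestronglyMeasurable.restrict.mul (hT.measurable.pow_const n).aestronglyMeasurable) ?_
  filter_upwards [ae_restrict_mem measurableSet_Ioi] with s hs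
  have hs0 : 0 ≤ ∫ t in Set.Ioi s, r t := setIntegral_nonneg measurableSet_Ioi fun t _ => h0 t
  rw [norm_mul, norm_pow, Real.norm_of_nonneg (h0 s), Real.norm_of_nonneg hs0]
  exact mul_le_mul_of_nonneg_left (pow_le_pow_left₀ hs0 (hT (le_of_lt hs)) n) (h0 s)

/-- The integral over the simplex that makes a Volterra series converge factorially. -/
lemma integral_mul_tail_pow {r : ℝ → ℝ} (hr : Integrable r) (h0 : ∀ t, 0 ≤ r t) (n : ℕ)
    (y : ℝ) : ∫ s in Set.Ioi y, r s * (∫ t in Set.Ioi s, r t) ^ n =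
      (∫ t in Set.Ioi y, r t) ^ (n + 1) / (n + 1) := by
  set T : ℝ → ℝ := fun y => ∫ t in Set.Ioi y, r t with hT
  have hTp : IsPrimitive (fun y => (T y : ℂ)) (fun t => -(r t : ℂ)) y := by
    have := isPrimitive_integral_Ioi (r := fun t => (r t : ℂ)) (a := y) hr.ofReal.integrableOn
    refine this.congr (fun x _ => ?_) (fun x _ => rfl)
    exact integral_ofReal.symm
  have hpow : ∀ n : ℕ, IsPrimitive (fun y => (T y : ℂ) ^ (n + 1))
      (fun t => -((n + 1 : ℂ)) * ((r t : ℂ) * (T t : ℂ) ^ n)) y := by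
    intro n
    induction n with
    | zero => exact hTp.congr (fun x _ => by ring) (fun x _ => by simp)
    | succ n ih =>
      refine (ih.mul hTp).congr (fun x _ => by ring) (fun x _ => ?_)
      push_cast
      ring
  have hint := integrableOn_mul_tail_pow hr h0 n y
  have hreal : ∀ b, y ≤ b → ∫ s in y..b, r s * T s ^ n =
      (T y ^ (n + 1) - T b ^ (n + 1)) / (n + 1) := by
    intro b hb
    have h1 := (hpow n).eq_add b hb
    rw [intervalIntegral.integral_const_mul] at h1
    have hn : (n + 1 : ℂ) ≠ 0 := by exact_mod_cast Nat.succ_ne_zero n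
    have h2 : ∫ s in y..b, (r s : ℂ) * (T s : ℂ) ^ n = ((∫ s in y..b, r s * T s ^ n : ℝ) : ℂ) := by
      rw [← intervalIntegral.integral_ofReal]
      push_cast
      rfl
    rw [h2] at h1
    have h3 : ((∫ s in y..b, r s * T s ^ n : ℝ) : ℂ) =
        (((T y ^ (n + 1) - T b ^ (n + 1)) / (n + 1) : ℝ) : ℂ) := by
      push_cast
      rw [eq_div_iff hn]
      linear_combination h1
    exact_mod_cast h3
  have l1 := intervalIntegral_tendsto_integral_Ioi y hint tendsto_id
  have l2 : Tendsto (fun b => (T y ^ (n + 1) - T b ^ (n + 1)) / (n + 1)) atTop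
      (𝓝 ((T y ^ (n + 1) - 0 ^ (n + 1)) / (n + 1))) :=
    (tendsto_const_nhds.sub
      ((tendsto_integral_Ioi_zero (a := y) hr.integrableOn).pow _)).div_const _
  have l3 := tendsto_nhds_unique (l1.congr' (by
    filter_upwards [eventually_ge_atTop y] with b hb using hreal b hb)) l2
  simpa using l3

end Tail

/-- An integral of functions holomorphic in a parameter is holomorphic, under domination on the
open parameter set; the derivative is controlled by Cauchy's estimate. -/
lemma differentiableOn_integral_of_dominated {α : Type*} [MeasurableSpace α] {μ : Measure α}
    {F : ℂ → α → ℂ} {U : Set ℂ} (hU : IsOpen U) {bound : α → ℝ}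
    (hmeas : ∀ k ∈ U, AEStronglyMeasurable (F k) μ)
    (hbound : ∀ᵐ t ∂μ, ∀ k ∈ U, ‖F k t‖ ≤ bound t) (hint : Integrable bound μ)
    (hdiff : ∀ᵐ t ∂μ, DifferentiableOn ℂ (fun k => F k t) U) :
    DifferentiableOn ℂ (fun k => ∫ t, F k t ∂μ) U := by
  intro k₀ hk₀
  obtain ⟨ε, hε, hball⟩ := Metric.isOpen_iff.1 hU k₀ hk₀
  have hε2 : 0 < ε / 2 := by positivity
  have hsub : ∀ k ∈ Metric.ball k₀ (ε / 2), Metric.closedBall k (ε / 4) ⊆ U := by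
    intro k hk z hz
    apply hball
    have h1 := Metric.mem_ball.1 hk
    have h2 := Metric.mem_closedBall.1 hz
    exact Metric.mem_ball.2 (by linarith [dist_triangle z k k₀])
  have hmem : ∀ k ∈ Metric.ball k₀ (ε / 2), k ∈ U := fun k hk =>
    hsub k hk (Metric.mem_closedBall_self (by positivity))
  have hd : ∀ᵐ t ∂μ, ∀ k ∈ Metric.ball k₀ (ε / 2),
      HasDerivAt (fun k => F k t) (deriv (fun k => F k t) k) k := by
    filter_upwards [hdiff] with t ht k hk
    exact (ht.differentiableAt (hU.mem_nhds (hmem k hk))).hasDerivAt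
  have hk₀' : k₀ ∈ Metric.ball k₀ (ε / 2) := Metric.mem_ball_self hε2
  have hderiv_meas : AEStronglyMeasurable (fun t => deriv (fun k => F k t) k₀) μ := by
    -- the derivative is the limit of the difference quotients along `k₀ + 1 / m`
    obtain ⟨N, hN⟩ := exists_nat_gt (2 / ε)
    let z : ℕ → ℂ := fun m => ((1 / ((m + N + 1 : ℕ) : ℝ) : ℝ) : ℂ)
    have hz0 : ∀ m, z m ≠ 0 := fun m => by
      simp only [z, Complex.ofReal_ne_zero]
      positivity
    have hzU : ∀ m, k₀ + z m ∈ U := by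
      intro m
      apply hmem
      rw [Metric.mem_ball, dist_eq_norm, add_sub_cancel_left, Complex.norm_real,
        Real.norm_of_nonneg (by positivity)]
      have hpos : (0 : ℝ) < ((m + N + 1 : ℕ) : ℝ) := by positivity
      rw [div_lt_iff₀ hpos]
      have : 2 / ε < ((m + N + 1 : ℕ) : ℝ) := hN.trans (by
        exact_mod_cast (by omega : N < m + N + 1))
      rw [div_lt_iff₀ hε] at this
      linarith
    have hzlim : Tendsto z atTop (𝓝[≠] 0) := by
      refine tendsto_nhdsWithin_iff.2 ⟨?_, Eventually.of_forall hz0⟩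
      have h1 : Tendsto (fun m : ℕ => 1 / ((m : ℝ) + 1)) atTop (𝓝 0) :=
        tendsto_one_div_add_atTop_nhds_zero_nat
      have h2 := (tendsto_add_atTop_iff_nat N).2 h1
      have h3 := (Complex.continuous_ofReal.tendsto 0).comp h2
      simpa [z, Function.comp_def] using h3
    refine aestronglyMeasurable_of_tendsto_ae (u := atTop)
      (f := fun m t => (z m)⁻¹ * (F (k₀ + z m) t - F k₀ t)) (fun m => ?_) ?_
    · exact ((hmeas _ (hzU m)).sub (hmeas _ hk₀)).const_mul _
    · filter_upwards [hd] with t ht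
      have := (hasDerivAt_iff_tendsto_slope_zero.1 (ht k₀ hk₀')).comp hzlim
      simpa [Function.comp_def] using this
  have hderiv_bound : ∀ᵐ t ∂μ, ∀ k ∈ Metric.ball k₀ (ε / 2),
      ‖deriv (fun k => F k t) k‖ ≤ bound t / (ε / 4) := by
    filter_upwards [hdiff, hbound] with t ht hb k hk
    refine Complex.norm_deriv_le_of_forall_mem_sphere_norm_le (by positivity) ?_ ?_
    · exact (ht.mono ((closure_mono Metric.ball_subset_closedBall).trans
        (Metric.isClosed_closedBall.closure_eq.subset.trans (hsub k hk)))).diffContOnCl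
    · intro w hw
      exact hb w (hsub k hk (Metric.sphere_subset_closedBall hw))
  refine DifferentiableAt.differentiableWithinAt (HasDerivAt.differentiableAt
    (hasDerivAt_integral_of_dominated_loc_of_deriv_le (F := F)
    (F' := fun k t => deriv (fun k => F k t) k) (bound := fun t => bound t / (ε / 4))
    (Metric.ball_mem_nhds k₀ hε2) ?_ ?_ hderiv_meas hderiv_bound (hint.div_const _) hd).2)
  · filter_upwards [Metric.ball_mem_nhds k₀ hε2] with k hk using hmeas k (hmem k hk)
  · exact hint.mono' (hmeas k₀ hk₀) (by filter_upwards [hbound] with t ht using ht k₀ hk₀)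

/-! ### The Volterra series for the Jost solution on the line -/

/-- The kernel `∫₀ᵘ e^{2iks} ds = (e^{2iku} - 1) / (2ik)` of the integral equation for
`e^{-iky}` times the Jost solution. The integral form covers `k = 0`. -/
noncomputable def jostKernel (k : ℂ) (u : ℝ) : ℂ :=
  ∫ s in (0 : ℝ)..u, Complex.exp (2 * Complex.I * k * s)

/-- A potential on the whole line for which the Volterra series at `+∞` converges. -/
structure IsLinePotential (Q : ℝ → ℝ) : Prop where
  integrable : Integrable Q
  moment : IntegrableOn (fun s => s * Q s) (Set.Ioi 0)

/-- The spectral parameters for which the series converges: the closed upper half-plane, and every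
`k ∈ ℂ` when the potential vanishes on `(0,∞)`. -/
def IsAdmissible (Q : ℝ → ℝ) (k : ℂ) : Prop := 0 ≤ k.im ∨ ∀ s, 0 < s → Q s = 0

/-- The growth rate `exp (2 (Im k)⁻ y⁻)` of the Volterra series; it is `1` for `Im k ≥ 0`. -/
noncomputable def jostWeight (k : ℂ) (y : ℝ) : ℝ := Real.exp (2 * max (-k.im) 0 * max (-y) 0)

/-- The first moment `∫_y^∞ (s - y) |Q s| ds` of the tail of the potential. -/
noncomputable def tailMoment (Q : ℝ → ℝ) (y : ℝ) : ℝ := ∫ s in Set.Ioi y, (s - y) * |Q s|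

/-- The iterated integrals of the Volterra series. -/
noncomputable def jostIterate (Q : ℝ → ℝ) (k : ℂ) : ℕ → ℝ → ℂ
  | 0, _ => 1
  | n + 1, y => ∫ s in Set.Ioi y, jostKernel k (s - y) * Q s * jostIterate Q k n s

/-- The sum of the Volterra series: `e^{-iky}` times the Jost solution at `+∞`. -/
noncomputable def jostSeries (Q : ℝ → ℝ) (k : ℂ) (y : ℝ) : ℂ := ∑' n, jostIterate Q k n y

/-- Minus the derivative in `y` of `jostSeries Q k y`. -/
noncomputable def jostSlope (Q : ℝ → ℝ) (k : ℂ) (y : ℝ) : ℂ :=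
  ∫ s in Set.Ioi y, Complex.exp (2 * Complex.I * k * (s - y : ℝ)) * Q s * jostSeries Q k s

lemma norm_cexp_two_I_mul (k : ℂ) (s : ℝ) :
    ‖Complex.exp (2 * Complex.I * k * s)‖ = Real.exp (-(2 * k.im * s)) := by
  rw [Complex.norm_exp]
  congr 1
  simp [mul_assoc]

lemma norm_cexp_two_I_mul_le (k : ℂ) {s : ℝ} (hs : 0 ≤ s) :
    ‖Complex.exp (2 * Complex.I * k * s)‖ ≤ Real.exp (2 * max (-k.im) 0 * s) := by
  rw [norm_cexp_two_I_mul]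
  apply Real.exp_le_exp.2
  nlinarith [le_max_left (-k.im) 0]

lemma norm_jostKernel_le (k : ℂ) {u : ℝ} (hu : 0 ≤ u) :
    ‖jostKernel k u‖ ≤ u * Real.exp (2 * max (-k.im) 0 * u) := by
  have h := intervalIntegral.norm_integral_le_of_norm_le_const (a := 0) (b := u)
    (f := fun s : ℝ => Complex.exp (2 * Complex.I * k * s))
    (C := Real.exp (2 * max (-k.im) 0 * u)) (fun s hs => by
      rw [Set.uIoc_of_le hu] at hs
      refine (norm_cexp_two_I_mul_le k hs.1.le).trans (Real.exp_le_exp.2 ?_)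
      exact mul_le_mul_of_nonneg_left hs.2 (by positivity))
  rw [sub_zero, abs_of_nonneg hu, mul_comm (Real.exp _) u] at h
  exact h

lemma jostKernel_eq {k : ℂ} (hk : k ≠ 0) (u : ℝ) :
    jostKernel k u = (Complex.exp (2 * Complex.I * k * u) - 1) / (2 * Complex.I * k) := by
  have h : 2 * Complex.I * k ≠ 0 := by simp [hk]
  rw [jostKernel, integral_exp_mul_complex h]
  simp

lemma continuous_jostKernel (k : ℂ) : Continuous (jostKernel k) :=
  intervalIntegral.continuous_primitive (fun a b => Continuous.intervalIntegrable
    (by fun_prop) a b) 0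

lemma jostWeight_pos (k : ℂ) (y : ℝ) : 0 < jostWeight k y := Real.exp_pos _

lemma jostWeight_anti (k : ℂ) : Antitone (jostWeight k) := by
  intro a b hab
  apply Real.exp_le_exp.2
  have : max (-b) 0 ≤ max (-a) 0 := max_le_max (by linarith) le_rfl
  gcongr

lemma one_le_jostWeight (k : ℂ) (y : ℝ) : 1 ≤ jostWeight k y := by
  rw [jostWeight]
  exact Real.one_le_exp (by positivity)

lemma jostWeight_of_im_nonneg {k : ℂ} (hk : 0 ≤ k.im) (y : ℝ) : jostWeight k y = 1 := by
  simp [jostWeight, hk]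

lemma jostWeight_le {k : ℂ} {ρ : ℝ} (hk : ‖k‖ ≤ ρ) (y : ℝ) :
    jostWeight k y ≤ Real.exp (2 * ρ * max (-y) 0) := by
  apply Real.exp_le_exp.2
  have h1 : max (-k.im) 0 ≤ ρ :=
    max_le ((neg_le_abs _).trans ((Complex.abs_im_le_norm k).trans hk)) ((norm_nonneg k).trans hk)
  gcongr

namespace IsAdmissible

variable {Q : ℝ → ℝ} {k : ℂ}

/-- The weight absorbs the growth of the exponential wherever the potential is nonzero. -/
lemma exp_mul_weight_le (hk : IsAdmissible Q k) {y s : ℝ} (hs : y ≤ s) :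
    Real.exp (2 * max (-k.im) 0 * (s - y)) * jostWeight k s * |Q s| ≤
      jostWeight k y * |Q s| := by
  by_cases hQ : Q s = 0
  · simp [hQ]
  refine mul_le_mul_of_nonneg_right ?_ (abs_nonneg _)
  rcases hk with hk | hk
  · simp [jostWeight, hk]
  · have hs0 : s ≤ 0 := not_lt.1 fun h => hQ (hk s h)
    rw [jostWeight, jostWeight, ← Real.exp_add, max_eq_left (by linarith : (0 : ℝ) ≤ -s),
      max_eq_left (by linarith : (0 : ℝ) ≤ -y)]
    apply le_of_eq
    ring_nf

lemma kernel_mul_weight_le (hk : IsAdmissible Q k) {y s : ℝ} (hs : y ≤ s) :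
    ‖jostKernel k (s - y)‖ * |Q s| * jostWeight k s ≤ jostWeight k y * ((s - y) * |Q s|) := by
  have h1 := norm_jostKernel_le k (sub_nonneg.2 hs)
  have h2 := hk.exp_mul_weight_le hs
  have h3 : 0 ≤ s - y := sub_nonneg.2 hs
  calc ‖jostKernel k (s - y)‖ * |Q s| * jostWeight k s
      ≤ ((s - y) * Real.exp (2 * max (-k.im) 0 * (s - y))) * |Q s| * jostWeight k s := by
        have := (jostWeight_pos k s).le
        gcongr
    _ = (s - y) * (Real.exp (2 * max (-k.im) 0 * (s - y)) * jostWeight k s * |Q s|) := by ring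
    _ ≤ (s - y) * (jostWeight k y * |Q s|) := by gcongr
    _ = _ := by ring

lemma cexp_mul_weight_le (hk : IsAdmissible Q k) {y s : ℝ} (hs : y ≤ s) :
    ‖Complex.exp (2 * Complex.I * k * (s - y : ℝ))‖ * |Q s| * jostWeight k s ≤
      jostWeight k y * |Q s| := by
  refine le_trans ?_ (hk.exp_mul_weight_le hs)
  have := norm_cexp_two_I_mul_le k (sub_nonneg.2 hs)
  have := (jostWeight_pos k s).le
  rw [mul_right_comm]
  gcongr

end IsAdmissible

namespace IsLinePotential

variable {Q : ℝ → ℝ} {k : ℂ}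

lemma integrableOn_moment (hQ : IsLinePotential Q) (y : ℝ) :
    IntegrableOn (fun s => (s - y) * |Q s|) (Set.Ioi y) := by
  have h1 : Integrable ((Set.Ioi 0).indicator fun s => s * Q s) :=
    (integrable_indicator_iff measurableSet_Ioi).2 hQ.moment
  have h2 := h1.norm.add (hQ.integrable.norm.const_mul |y|)
  refine Integrable.mono' h2.integrableOn ?_ ?_
  · exact ((continuous_id.sub continuous_const).aestronglyMeasurable.mul
      hQ.integrable.aestronglyMeasurable.norm).restrict
  · filter_upwards [ae_restrict_mem measurableSet_Ioi] with s hs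
    have hs' : y < s := hs
    rw [norm_mul, Real.norm_of_nonneg (by linarith : 0 ≤ s - y), Real.norm_eq_abs, abs_abs]
    simp only [Pi.add_apply, Real.norm_eq_abs]
    have hy := neg_abs_le y
    by_cases h0 : 0 < s
    · rw [Set.indicator_of_mem (show s ∈ Set.Ioi (0 : ℝ) from h0), abs_mul, abs_of_pos h0]
      nlinarith [abs_nonneg (Q s)]
    · rw [Set.indicator_of_notMem (show s ∉ Set.Ioi (0 : ℝ) from h0)]
      have : s - y ≤ |y| := by linarith [not_lt.1 h0]
      have := mul_le_mul_of_nonneg_right this (abs_nonneg (Q s))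
      simpa using this

lemma tailMoment_nonneg (Q : ℝ → ℝ) (y : ℝ) : 0 ≤ tailMoment Q y :=
  setIntegral_nonneg measurableSet_Ioi fun _ hs =>
    mul_nonneg (sub_nonneg.2 (le_of_lt hs)) (abs_nonneg _)

lemma tailMoment_anti (hQ : IsLinePotential Q) : Antitone (tailMoment Q) := by
  intro a b hab
  calc tailMoment Q b ≤ ∫ s in Set.Ioi b, (s - a) * |Q s| := by
        refine setIntegral_mono_on (hQ.integrableOn_moment b)
          ((hQ.integrableOn_moment a).mono_set (Set.Ioi_subset_Ioi hab)) measurableSet_Ioi ?_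
        exact fun _ _ => by gcongr
    _ ≤ tailMoment Q a := by
        refine setIntegral_mono_set (hQ.integrableOn_moment a) ?_
          (Set.Ioi_subset_Ioi hab).eventuallyLE
        filter_upwards [ae_restrict_mem measurableSet_Ioi] with s hs
        exact mul_nonneg (sub_nonneg.2 (le_of_lt hs)) (abs_nonneg _)

lemma aestronglyMeasurable_jostIterate (hQ : IsLinePotential Q) (k : ℂ) (n : ℕ) :
    AEStronglyMeasurable (jostIterate Q k n) volume := by
  induction n with
  | zero => exact aestronglyMeasurable_const
  | succ n ih =>
    have h1 : AEStronglyMeasurable (fun z : ℝ × ℝ =>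
        ({z : ℝ × ℝ | z.1 < z.2}.indicator (fun _ => (1 : ℂ)) z) *
          (jostKernel k (z.2 - z.1) * Q z.2 * jostIterate Q k n z.2)) (volume.prod volume) := by
      refine AEStronglyMeasurable.mul ?_
        (AEStronglyMeasurable.mul (AEStronglyMeasurable.mul ?_ ?_) ?_)
      · exact (stronglyMeasurable_const.indicator
          (measurableSet_lt measurable_fst measurable_snd)).aestronglyMeasurable
      · exact ((continuous_jostKernel k).comp
          (continuous_snd.sub continuous_fst)).aestronglyMeasurable
      · exact (Complex.continuous_ofReal.comp_aestronglyMeasurable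
          hQ.integrable.aestronglyMeasurable).comp_snd
      · exact ih.comp_snd
    have h2 := h1.integral_prod_right'
    refine h2.congr (Eventually.of_forall fun y => ?_)
    simp only [jostIterate]
    rw [← integral_indicator measurableSet_Ioi]
    refine integral_congr_ae (Eventually.of_forall fun s => ?_)
    by_cases hs : y < s
    · simp [Set.indicator, hs]
    · simp [Set.indicator, hs]

lemma norm_jostIterate_le (hQ : IsLinePotential Q) (hk : IsAdmissible Q k) (n : ℕ) (y : ℝ) :
    ‖jostIterate Q k n y‖ ≤ jostWeight k y * (tailMoment Q y ^ n / n.factorial) := by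
  set r : ℝ → ℝ := (Set.Ioi y).indicator fun s => (s - y) * |Q s| with hr
  have hr0 : ∀ t, 0 ≤ r t :=
    Set.indicator_nonneg fun s hs => mul_nonneg (sub_nonneg.2 (le_of_lt hs)) (abs_nonneg (Q s))
  have hri : Integrable r :=
    (integrable_indicator_iff measurableSet_Ioi).2 (hQ.integrableOn_moment y)
  have key : ∀ n : ℕ, ∀ z, y ≤ z →
      ‖jostIterate Q k n z‖ ≤ jostWeight k z * ((∫ t in Set.Ioi z, r t) ^ n / n.factorial) := by
    intro n
    induction n with
    | zero =>
      intro z _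
      simpa [jostIterate] using one_le_jostWeight k z
    | succ n ih =>
      intro z hz
      have hb : ∀ s ∈ Set.Ioi z, ‖jostKernel k (s - z) * Q s * jostIterate Q k n s‖ ≤
          jostWeight k z / n.factorial * (r s * (∫ t in Set.Ioi s, r t) ^ n) := by
        intro s hs
        have hs' : z < s := hs
        have h1 := ih s (hz.trans hs'.le)
        have h2 := hk.kernel_mul_weight_le hs'.le
        have hT : 0 ≤ ∫ t in Set.Ioi s, r t := integral_nonneg hr0
        have hrs : r s = (s - y) * |Q s| :=
          Set.indicator_of_mem (show s ∈ Set.Ioi y from lt_of_le_of_lt hz hs') _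
        have hw := (jostWeight_pos k z).le
        rw [norm_mul, norm_mul, Complex.norm_real, Real.norm_eq_abs]
        calc ‖jostKernel k (s - z)‖ * |Q s| * ‖jostIterate Q k n s‖
            ≤ ‖jostKernel k (s - z)‖ * |Q s| *
              (jostWeight k s * ((∫ t in Set.Ioi s, r t) ^ n / n.factorial)) := by gcongr
          _ = (‖jostKernel k (s - z)‖ * |Q s| * jostWeight k s) *
              ((∫ t in Set.Ioi s, r t) ^ n / n.factorial) := by ring
          _ ≤ (jostWeight k z * ((s - z) * |Q s|)) *
              ((∫ t in Set.Ioi s, r t) ^ n / n.factorial) := by gcongr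
          _ ≤ (jostWeight k z * ((s - y) * |Q s|)) *
              ((∫ t in Set.Ioi s, r t) ^ n / n.factorial) := by gcongr
          _ = _ := by rw [hrs]; ring
      have h3 := norm_integral_le_of_norm_le
        ((integrableOn_mul_tail_pow hri hr0 n z).const_mul (jostWeight k z / n.factorial))
        ((ae_restrict_iff' measurableSet_Ioi).2 (Eventually.of_forall hb))
      rw [integral_const_mul, integral_mul_tail_pow hri hr0] at h3
      refine h3.trans (le_of_eq ?_)
      rw [Nat.factorial_succ]
      push_cast
      have : (n.factorial : ℝ) ≠ 0 := by exact_mod_cast n.factorial_ne_zero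
      field_simp
  have h := key n y le_rfl
  have hT : ∫ t in Set.Ioi y, r t = tailMoment Q y :=
    setIntegral_congr_fun measurableSet_Ioi fun s hs => Set.indicator_of_mem hs _
  rwa [hT] at h

lemma hasSum_bound (k : ℂ) (Q : ℝ → ℝ) (y : ℝ) :
    HasSum (fun n : ℕ => jostWeight k y * (tailMoment Q y ^ n / n.factorial))
      (jostWeight k y * Real.exp (tailMoment Q y)) := by
  rw [Real.exp_eq_exp_ℝ]
  exact (NormedSpace.expSeries_div_hasSum_exp (tailMoment Q y)).mul_left _

lemma hasSum_jostSeries (hQ : IsLinePotential Q) (hk : IsAdmissible Q k) (y : ℝ) :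
    HasSum (fun n => jostIterate Q k n y) (jostSeries Q k y) :=
  (Summable.of_norm_bounded (hasSum_bound k Q y).summable
    (fun n => hQ.norm_jostIterate_le hk n y)).hasSum

lemma norm_jostSeries_le (hQ : IsLinePotential Q) (hk : IsAdmissible Q k) (y : ℝ) :
    ‖jostSeries Q k y‖ ≤ jostWeight k y * Real.exp (tailMoment Q y) :=
  tsum_of_norm_bounded (hasSum_bound k Q y) (fun n => hQ.norm_jostIterate_le hk n y)

lemma aestronglyMeasurable_jostSeries (hQ : IsLinePotential Q) (hk : IsAdmissible Q k) :
    AEStronglyMeasurable (jostSeries Q k) volume := by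
  refine aestronglyMeasurable_of_tendsto_ae (u := atTop)
    (f := fun N : ℕ => fun y => ∑ n ∈ Finset.range N, jostIterate Q k n y) (fun N => ?_) ?_
  · exact Finset.aestronglyMeasurable_fun_sum _
      fun n _ => hQ.aestronglyMeasurable_jostIterate k n
  · exact Eventually.of_forall fun y => (hQ.hasSum_jostSeries hk y).tendsto_sum_nat

lemma aestronglyMeasurable_kernel_mul (hQ : IsLinePotential Q) (k : ℂ) (y : ℝ) {g : ℝ → ℂ}
    (hg : AEStronglyMeasurable g volume) :
    AEStronglyMeasurable (fun s => jostKernel k (s - y) * Q s * g s)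
      (volume.restrict (Set.Ioi y)) :=
  ((((continuous_jostKernel k).comp (continuous_id.sub continuous_const)).aestronglyMeasurable.mul
    (Complex.continuous_ofReal.comp_aestronglyMeasurable
      hQ.integrable.aestronglyMeasurable)).mul hg).restrict

/-- The integral equation. -/
lemma jostSeries_eq (hQ : IsLinePotential Q) (hk : IsAdmissible Q k) (y : ℝ) :
    jostSeries Q k y =
      1 + ∫ s in Set.Ioi y, jostKernel k (s - y) * Q s * jostSeries Q k s := by
  have hs : HasSum (fun n => jostIterate Q k (n + 1) y)
      (∫ s in Set.Ioi y, jostKernel k (s - y) * Q s * jostSeries Q k s) := by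
    refine hasSum_integral_of_dominated_convergence
      (fun n s => jostWeight k y * ((s - y) * |Q s|) * (tailMoment Q y ^ n / n.factorial))
      (fun n => hQ.aestronglyMeasurable_kernel_mul k y (hQ.aestronglyMeasurable_jostIterate k n))
      (fun n => ?_) ?_ ?_ ?_
    · filter_upwards [ae_restrict_mem measurableSet_Ioi] with s hs
      have hs' : y < s := hs
      have h1 := hQ.norm_jostIterate_le hk n s
      have h2 := hk.kernel_mul_weight_le hs'.le
      have h3 := hQ.tailMoment_anti hs'.le
      have h4 := tailMoment_nonneg Q s
      rw [norm_mul, norm_mul, Complex.norm_real, Real.norm_eq_abs]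
      have hm : 0 ≤ jostWeight k y * ((s - y) * |Q s|) :=
        mul_nonneg (jostWeight_pos k y).le (mul_nonneg (by linarith) (abs_nonneg _))
      calc ‖jostKernel k (s - y)‖ * |Q s| * ‖jostIterate Q k n s‖
          ≤ ‖jostKernel k (s - y)‖ * |Q s| *
            (jostWeight k s * (tailMoment Q s ^ n / n.factorial)) := by gcongr
        _ = (‖jostKernel k (s - y)‖ * |Q s| * jostWeight k s) *
            (tailMoment Q s ^ n / n.factorial) := by ring
        _ ≤ (jostWeight k y * ((s - y) * |Q s|)) *
            (tailMoment Q y ^ n / n.factorial) := by gcongr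
    · exact Eventually.of_forall fun s =>
        (NormedSpace.expSeries_div_summable (tailMoment Q y)).mul_left _
    · simp_rw [tsum_mul_left]
      exact ((hQ.integrableOn_moment y).const_mul _).mul_const _
    · exact Eventually.of_forall fun s => (hQ.hasSum_jostSeries hk s).mul_left _
  have h := (hasSum_nat_add_iff' (f := fun n => jostIterate Q k n y) 1).2
    (hQ.hasSum_jostSeries hk y)
  have := hs.unique h
  rw [this]
  simp [jostIterate]

lemma norm_cexp_mul_jostSeries_le (hQ : IsLinePotential Q) (hk : IsAdmissible Q k) {y s : ℝ}
    (hs : y ≤ s) :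
    ‖Complex.exp (2 * Complex.I * k * (s - y : ℝ)) * Q s * jostSeries Q k s‖ ≤
      jostWeight k y * Real.exp (tailMoment Q y) * |Q s| := by
  have h1 := hQ.norm_jostSeries_le hk s
  have h2 := hk.cexp_mul_weight_le hs
  have h3 := hQ.tailMoment_anti hs
  rw [norm_mul, norm_mul, Complex.norm_real, Real.norm_eq_abs]
  calc ‖Complex.exp (2 * Complex.I * k * (s - y : ℝ))‖ * |Q s| * ‖jostSeries Q k s‖
      ≤ ‖Complex.exp (2 * Complex.I * k * (s - y : ℝ))‖ * |Q s| *
        (jostWeight k s * Real.exp (tailMoment Q s)) := by gcongr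
    _ = ‖Complex.exp (2 * Complex.I * k * (s - y : ℝ))‖ * |Q s| * jostWeight k s *
        Real.exp (tailMoment Q s) := by ring
    _ ≤ jostWeight k y * |Q s| * Real.exp (tailMoment Q y) := by
        have := (jostWeight_pos k y).le
        gcongr
    _ = _ := by ring

lemma aestronglyMeasurable_cexp_mul (hQ : IsLinePotential Q) (hk : IsAdmissible Q k) (y : ℝ) :
    AEStronglyMeasurable
      (fun s : ℝ => Complex.exp (2 * Complex.I * k * (s - y : ℝ)) * Q s * jostSeries Q k s)
      (volume.restrict (Set.Ioi y)) := by
  refine AEStronglyMeasurable.restrict (AEStronglyMeasurable.mul (AEStronglyMeasurable.mul ?_ ?_)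
    (hQ.aestronglyMeasurable_jostSeries hk))
  · exact Continuous.aestronglyMeasurable (by fun_prop)
  · exact Complex.continuous_ofReal.comp_aestronglyMeasurable hQ.integrable.aestronglyMeasurable

lemma integrableOn_cexp_mul (hQ : IsLinePotential Q) (hk : IsAdmissible Q k) (y : ℝ) :
    IntegrableOn
      (fun s : ℝ => Complex.exp (2 * Complex.I * k * (s - y : ℝ)) * Q s * jostSeries Q k s)
      (Set.Ioi y) := by
  refine Integrable.mono' (hQ.integrable.abs.integrableOn.const_mul
    (jostWeight k y * Real.exp (tailMoment Q y))) (hQ.aestronglyMeasurable_cexp_mul hk y) ?_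
  filter_upwards [ae_restrict_mem measurableSet_Ioi] with s hs
  exact hQ.norm_cexp_mul_jostSeries_le hk (le_of_lt hs)

lemma norm_jostSlope_le (hQ : IsLinePotential Q) (hk : IsAdmissible Q k) (y : ℝ) :
    ‖jostSlope Q k y‖ ≤
      jostWeight k y * Real.exp (tailMoment Q y) * ∫ s in Set.Ioi y, |Q s| := by
  rw [← integral_const_mul]
  refine norm_integral_le_of_norm_le (hQ.integrable.abs.integrableOn.const_mul _) ?_
  filter_upwards [ae_restrict_mem measurableSet_Ioi] with s hs
  exact hQ.norm_cexp_mul_jostSeries_le hk (le_of_lt hs)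

lemma norm_kernel_mul_jostSeries_le (hQ : IsLinePotential Q) (hk : IsAdmissible Q k) {y s : ℝ}
    (hs : y ≤ s) :
    ‖jostKernel k (s - y) * Q s * jostSeries Q k s‖ ≤
      jostWeight k y * Real.exp (tailMoment Q y) * ((s - y) * |Q s|) := by
  have h1 := hQ.norm_jostSeries_le hk s
  have h2 := hk.kernel_mul_weight_le hs
  have h3 := hQ.tailMoment_anti hs
  rw [norm_mul, norm_mul, Complex.norm_real, Real.norm_eq_abs]
  have hm : 0 ≤ jostWeight k y * ((s - y) * |Q s|) :=
    mul_nonneg (jostWeight_pos k y).le (mul_nonneg (by linarith) (abs_nonneg _))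
  calc ‖jostKernel k (s - y)‖ * |Q s| * ‖jostSeries Q k s‖
      ≤ ‖jostKernel k (s - y)‖ * |Q s| *
        (jostWeight k s * Real.exp (tailMoment Q s)) := by gcongr
    _ = ‖jostKernel k (s - y)‖ * |Q s| * jostWeight k s * Real.exp (tailMoment Q s) := by ring
    _ ≤ jostWeight k y * ((s - y) * |Q s|) * Real.exp (tailMoment Q y) := by gcongr
    _ = _ := by ring

lemma norm_jostSeries_sub_one_le (hQ : IsLinePotential Q) (hk : IsAdmissible Q k) (y : ℝ) :
    ‖jostSeries Q k y - 1‖ ≤ jostWeight k y * Real.exp (tailMoment Q y) * tailMoment Q y := by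
  rw [hQ.jostSeries_eq hk y, add_sub_cancel_left, tailMoment, ← integral_const_mul]
  refine norm_integral_le_of_norm_le ((hQ.integrableOn_moment y).const_mul _) ?_
  filter_upwards [ae_restrict_mem measurableSet_Ioi] with s hs
  exact hQ.norm_kernel_mul_jostSeries_le hk (le_of_lt hs)

/-- In the upper half-plane the Volterra series is `1 + O(1/k)`. -/
lemma norm_jostSeries_sub_one_le_div (hQ : IsLinePotential Q) (hk : 0 ≤ k.im) (hk0 : k ≠ 0)
    (y : ℝ) : ‖jostSeries Q k y - 1‖ ≤
      Real.exp (tailMoment Q y) * (∫ s in Set.Ioi y, |Q s|) / ‖k‖ := by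
  have hka : IsAdmissible Q k := Or.inl hk
  have hkpos : 0 < ‖k‖ := norm_pos_iff.2 hk0
  rw [hQ.jostSeries_eq hka y, add_sub_cancel_left, mul_div_right_comm, ← integral_const_mul]
  refine norm_integral_le_of_norm_le (hQ.integrable.abs.integrableOn.const_mul _) ?_
  filter_upwards [ae_restrict_mem measurableSet_Ioi] with s hs
  have hs' : 0 ≤ s - y := sub_nonneg.2 (le_of_lt hs)
  have h1 := hQ.norm_jostSeries_le hka s
  rw [jostWeight_of_im_nonneg hk, one_mul] at h1
  have h2 := hQ.tailMoment_anti (le_of_lt hs)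
  have h3 : ‖jostKernel k (s - y)‖ ≤ 1 / ‖k‖ := by
    rw [jostKernel_eq hk0, norm_div]
    have h4 : ‖Complex.exp (2 * Complex.I * k * (s - y : ℝ)) - 1‖ ≤ 2 := by
      refine (norm_sub_le _ _).trans ?_
      have := norm_cexp_two_I_mul_le k hs'
      rw [max_eq_right (by linarith : -k.im ≤ 0)] at this
      simp only [mul_zero, zero_mul, Real.exp_zero] at this
      rw [norm_one]
      linarith
    have h5 : ‖2 * Complex.I * k‖ = 2 * ‖k‖ := by simp
    rw [h5, div_le_div_iff₀ (by positivity) hkpos]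
    nlinarith
  rw [norm_mul, norm_mul, Complex.norm_real, Real.norm_eq_abs]
  calc ‖jostKernel k (s - y)‖ * |Q s| * ‖jostSeries Q k s‖
      ≤ 1 / ‖k‖ * |Q s| * Real.exp (tailMoment Q y) := by
        gcongr
        exact h1.trans (Real.exp_le_exp.2 h2)
    _ = _ := by ring

lemma tendsto_tailMoment (hQ : IsLinePotential Q) : Tendsto (tailMoment Q) atTop (𝓝 0) := by
  refine squeeze_zero' (Eventually.of_forall (tailMoment_nonneg Q)) ?_
    (tendsto_integral_Ioi_zero (hQ.integrableOn_moment 0))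
  filter_upwards [eventually_ge_atTop 0] with y hy
  refine setIntegral_mono_on (hQ.integrableOn_moment y)
    ((hQ.integrableOn_moment 0).mono_set (Set.Ioi_subset_Ioi hy)) measurableSet_Ioi ?_
  exact fun s _ => by gcongr

lemma tendsto_jostSeries (hQ : IsLinePotential Q) (hk : 0 ≤ k.im) :
    Tendsto (jostSeries Q k) atTop (𝓝 1) := by
  rw [tendsto_iff_norm_sub_tendsto_zero]
  refine squeeze_zero (fun _ => norm_nonneg _)
    (fun y => hQ.norm_jostSeries_sub_one_le (Or.inl hk) y) ?_
  simp_rw [jostWeight_of_im_nonneg hk, one_mul]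
  simpa using ((Real.continuous_exp.tendsto 0).comp hQ.tendsto_tailMoment).mul
    hQ.tendsto_tailMoment

lemma tendsto_jostSlope (hQ : IsLinePotential Q) (hk : 0 ≤ k.im) :
    Tendsto (jostSlope Q k) atTop (𝓝 0) := by
  refine squeeze_zero_norm (fun y => hQ.norm_jostSlope_le (Or.inl hk) y) ?_
  simp_rw [jostWeight_of_im_nonneg hk, one_mul]
  simpa using ((Real.continuous_exp.tendsto 0).comp hQ.tendsto_tailMoment).mul
    (tendsto_integral_Ioi_zero (a := 0) hQ.integrable.abs.integrableOn)

/-! ### Dependence on the spectral parameter -/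

section Parameter

variable {S : Set ℂ} {ρ : ℝ}

lemma continuous_jostKernel_param (u : ℝ) : Continuous fun k => jostKernel k u := by
  unfold jostKernel
  exact intervalIntegral.continuous_parametric_intervalIntegral_of_continuous' (by fun_prop) _ _

lemma differentiable_jostKernel_param (u : ℝ) : Differentiable ℂ fun k => jostKernel k u := by
  intro k
  by_cases hk : k = 0
  · subst hk
    refine (Complex.differentiableOn_compl_singleton_and_continuousAt_iff
      (s := Set.univ) (c := (0 : ℂ)) Filter.univ_mem).1
      ⟨?_, (continuous_jostKernel_param u).continuousAt⟩ |>.differentiableAt Filter.univ_mem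
    intro k hk
    have hk0 : k ≠ 0 := hk.2
    have h : DifferentiableAt ℂ
        (fun k : ℂ => (Complex.exp (2 * Complex.I * k * u) - 1) / (2 * Complex.I * k)) k := by
      refine DifferentiableAt.div (by fun_prop) (by fun_prop) (by simp [hk0])
    refine (h.congr_of_eventuallyEq ?_).differentiableWithinAt
    filter_upwards [isOpen_ne.mem_nhds hk0] with z hz using jostKernel_eq hz u
  · have h : DifferentiableAt ℂ
        (fun k : ℂ => (Complex.exp (2 * Complex.I * k * u) - 1) / (2 * Complex.I * k)) k := by
      refine DifferentiableAt.div (by fun_prop) (by fun_prop) (by simp [hk])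
    refine h.congr_of_eventuallyEq ?_
    filter_upwards [isOpen_ne.mem_nhds hk] with z hz using jostKernel_eq hz u

lemma norm_jostIterate_le_of_norm_le (hQ : IsLinePotential Q) (hS : ∀ k ∈ S, IsAdmissible Q k)
    (hρ : ∀ k ∈ S, ‖k‖ ≤ ρ) (n : ℕ) (y : ℝ) {k : ℂ} (hk : k ∈ S) :
    ‖jostIterate Q k n y‖ ≤
      Real.exp (2 * ρ * max (-y) 0) * (tailMoment Q y ^ n / n.factorial) := by
  refine (hQ.norm_jostIterate_le (hS k hk) n y).trans ?_
  have := jostWeight_le (hρ k hk) y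
  have := tailMoment_nonneg Q y
  gcongr

/-- A bound, uniform in `k ∈ S`, for the integrand that defines the iterates. -/
lemma norm_kernel_mul_jostIterate_le (hQ : IsLinePotential Q) (hS : ∀ k ∈ S, IsAdmissible Q k)
    (hρ : ∀ k ∈ S, ‖k‖ ≤ ρ) (n : ℕ) {y s : ℝ} (hs : y ≤ s) {k : ℂ} (hk : k ∈ S) :
    ‖jostKernel k (s - y) * Q s * jostIterate Q k n s‖ ≤
      Real.exp (2 * ρ * max (-y) 0) * (tailMoment Q y ^ n / n.factorial) * ((s - y) * |Q s|) := by
  have h1 := hQ.norm_jostIterate_le (hS k hk) n s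
  have h2 := (hS k hk).kernel_mul_weight_le hs
  have h3 := hQ.tailMoment_anti hs
  have h4 := tailMoment_nonneg Q s
  have h5 := jostWeight_le (hρ k hk) y
  have h6 := (jostWeight_pos k y).le
  have h7 : 0 ≤ s - y := sub_nonneg.2 hs
  have h8 := tailMoment_nonneg Q y
  rw [norm_mul, norm_mul, Complex.norm_real, Real.norm_eq_abs]
  calc ‖jostKernel k (s - y)‖ * |Q s| * ‖jostIterate Q k n s‖
      ≤ ‖jostKernel k (s - y)‖ * |Q s| *
        (jostWeight k s * (tailMoment Q s ^ n / n.factorial)) := by gcongr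
    _ = (‖jostKernel k (s - y)‖ * |Q s| * jostWeight k s) *
        (tailMoment Q s ^ n / n.factorial) := by ring
    _ ≤ (jostWeight k y * ((s - y) * |Q s|)) * (tailMoment Q y ^ n / n.factorial) := by gcongr
    _ ≤ (Real.exp (2 * ρ * max (-y) 0) * ((s - y) * |Q s|)) *
        (tailMoment Q y ^ n / n.factorial) := by gcongr
    _ = _ := by ring

lemma continuousOn_jostIterate (hQ : IsLinePotential Q) (hS : ∀ k ∈ S, IsAdmissible Q k)
    (hρ : ∀ k ∈ S, ‖k‖ ≤ ρ) (n : ℕ) : ∀ y, ContinuousOn (fun k => jostIterate Q k n y) S := by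
  induction n with
  | zero => exact fun y => continuousOn_const
  | succ n ih =>
    intro y
    refine continuousOn_of_dominated (fun k _ => hQ.aestronglyMeasurable_kernel_mul k y
      (hQ.aestronglyMeasurable_jostIterate k n)) (fun k hk => ?_)
      ((hQ.integrableOn_moment y).const_mul
        (Real.exp (2 * ρ * max (-y) 0) * (tailMoment Q y ^ n / n.factorial))) ?_
    · filter_upwards [ae_restrict_mem measurableSet_Ioi] with s hs
      exact hQ.norm_kernel_mul_jostIterate_le hS hρ n (le_of_lt hs) hk
    · exact Eventually.of_forall fun s =>
        (((continuous_jostKernel_param (s - y)).continuousOn).mul continuousOn_const).mul (ih s)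

lemma differentiableOn_jostIterate (hQ : IsLinePotential Q) (hS : ∀ k ∈ S, IsAdmissible Q k)
    (hρ : ∀ k ∈ S, ‖k‖ ≤ ρ) (ho : IsOpen S) (n : ℕ) :
    ∀ y, DifferentiableOn ℂ (fun k => jostIterate Q k n y) S := by
  induction n with
  | zero => exact fun y => differentiableOn_const _
  | succ n ih =>
    intro y
    refine differentiableOn_integral_of_dominated ho
      (fun k _ => hQ.aestronglyMeasurable_kernel_mul k y
      (hQ.aestronglyMeasurable_jostIterate k n)) ?_
      ((hQ.integrableOn_moment y).const_mul
        (Real.exp (2 * ρ * max (-y) 0) * (tailMoment Q y ^ n / n.factorial))) ?_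
    · filter_upwards [ae_restrict_mem measurableSet_Ioi] with s hs k hk
      exact hQ.norm_kernel_mul_jostIterate_le hS hρ n (le_of_lt hs) hk
    · exact Eventually.of_forall fun s =>
        (((differentiable_jostKernel_param (s - y)).differentiableOn).mul
          (differentiableOn_const _)).mul (ih s)

lemma continuousOn_jostSeries (hQ : IsLinePotential Q) (hS : ∀ k ∈ S, IsAdmissible Q k)
    (hρ : ∀ k ∈ S, ‖k‖ ≤ ρ) (y : ℝ) : ContinuousOn (fun k => jostSeries Q k y) S :=
  continuousOn_tsum (fun n => hQ.continuousOn_jostIterate hS hρ n y)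
    ((NormedSpace.expSeries_div_summable (tailMoment Q y)).mul_left _)
    fun n _ hk => hQ.norm_jostIterate_le_of_norm_le hS hρ n y hk

lemma differentiableOn_jostSeries (hQ : IsLinePotential Q) (hS : ∀ k ∈ S, IsAdmissible Q k)
    (hρ : ∀ k ∈ S, ‖k‖ ≤ ρ) (ho : IsOpen S) (y : ℝ) :
    DifferentiableOn ℂ (fun k => jostSeries Q k y) S :=
  Complex.differentiableOn_tsum_of_summable_norm
    ((NormedSpace.expSeries_div_summable (tailMoment Q y)).mul_left _)
    (fun n => hQ.differentiableOn_jostIterate hS hρ ho n y) ho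
    fun n _ hk => hQ.norm_jostIterate_le_of_norm_le hS hρ n y hk

lemma norm_cexp_mul_jostSeries_le_of_norm_le (hQ : IsLinePotential Q)
    (hS : ∀ k ∈ S, IsAdmissible Q k) (hρ : ∀ k ∈ S, ‖k‖ ≤ ρ) {y s : ℝ} (hs : y ≤ s) {k : ℂ}
    (hk : k ∈ S) :
    ‖Complex.exp (2 * Complex.I * k * (s - y : ℝ)) * Q s * jostSeries Q k s‖ ≤
      Real.exp (2 * ρ * max (-y) 0) * Real.exp (tailMoment Q y) * |Q s| := by
  refine (hQ.norm_cexp_mul_jostSeries_le (hS k hk) hs).trans ?_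
  have := jostWeight_le (hρ k hk) y
  gcongr

lemma continuousOn_jostSlope (hQ : IsLinePotential Q) (hS : ∀ k ∈ S, IsAdmissible Q k)
    (hρ : ∀ k ∈ S, ‖k‖ ≤ ρ) (y : ℝ) : ContinuousOn (fun k => jostSlope Q k y) S := by
  refine continuousOn_of_dominated (fun k hk => hQ.aestronglyMeasurable_cexp_mul (hS k hk) y)
    (fun k hk => ?_) (hQ.integrable.abs.integrableOn.const_mul
      (Real.exp (2 * ρ * max (-y) 0) * Real.exp (tailMoment Q y))) ?_
  · filter_upwards [ae_restrict_mem measurableSet_Ioi] with s hs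
    exact hQ.norm_cexp_mul_jostSeries_le_of_norm_le hS hρ (le_of_lt hs) hk
  · exact Eventually.of_forall fun s => (Continuous.continuousOn (by fun_prop)).mul
      (hQ.continuousOn_jostSeries hS hρ s)

lemma differentiableOn_jostSlope (hQ : IsLinePotential Q) (hS : ∀ k ∈ S, IsAdmissible Q k)
    (hρ : ∀ k ∈ S, ‖k‖ ≤ ρ) (ho : IsOpen S) (y : ℝ) :
    DifferentiableOn ℂ (fun k => jostSlope Q k y) S := by
  refine differentiableOn_integral_of_dominated ho
    (fun k hk => hQ.aestronglyMeasurable_cexp_mul (hS k hk) y) ?_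
    (hQ.integrable.abs.integrableOn.const_mul
      (Real.exp (2 * ρ * max (-y) 0) * Real.exp (tailMoment Q y))) ?_
  · filter_upwards [ae_restrict_mem measurableSet_Ioi] with s hs k hk
    exact hQ.norm_cexp_mul_jostSeries_le_of_norm_le hS hρ (le_of_lt hs) hk
  · exact Eventually.of_forall fun s => (Differentiable.differentiableOn (by fun_prop)).mul
      (hQ.differentiableOn_jostSeries hS hρ ho s)

/-- The Volterra series is entire in `k` for a potential that vanishes on `(0,∞)`. -/
lemma differentiable_jostSeries (hQ : IsLinePotential Q) (h0 : ∀ s, 0 < s → Q s = 0) (y : ℝ) :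
    Differentiable ℂ fun k => jostSeries Q k y := by
  intro k
  have h := hQ.differentiableOn_jostSeries (S := Metric.ball 0 (‖k‖ + 1)) (ρ := ‖k‖ + 1)
    (fun _ _ => Or.inr h0) (fun z hz => by
      rw [mem_ball_zero_iff] at hz; exact hz.le) Metric.isOpen_ball y
  exact h.differentiableAt (Metric.isOpen_ball.mem_nhds (by simp))

lemma continuousOn_upper {f : ℂ → ℂ}
    (h : ∀ ρ : ℝ, ContinuousOn f ({k | 0 ≤ k.im} ∩ Metric.ball 0 ρ)) :
    ContinuousOn f {k | 0 ≤ k.im} := by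
  intro k hk
  have h1 := h (‖k‖ + 1) k ⟨hk, by simp⟩
  rwa [ContinuousWithinAt, nhdsWithin_inter_of_mem'
    (mem_nhdsWithin_of_mem_nhds (Metric.isOpen_ball.mem_nhds (by simp)))] at h1

lemma isOpen_upper_inter_ball (ρ : ℝ) : IsOpen ({k : ℂ | 0 < k.im} ∩ Metric.ball 0 ρ) :=
  (isOpen_lt continuous_const Complex.continuous_im).inter Metric.isOpen_ball

lemma differentiableOn_upper {f : ℂ → ℂ}
    (h : ∀ ρ : ℝ, DifferentiableOn ℂ f ({k | 0 < k.im} ∩ Metric.ball 0 ρ)) :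
    DifferentiableOn ℂ f {k | 0 < k.im} := by
  intro k hk
  exact ((h (‖k‖ + 1)).differentiableAt
    ((isOpen_upper_inter_ball _).mem_nhds ⟨hk, by simp⟩)).differentiableWithinAt

end Parameter

/-! ### The symmetry `k ↦ -k̄` -/

lemma jostKernel_neg_conj (k : ℂ) (u : ℝ) :
    jostKernel (-(starRingEnd ℂ) k) u = (starRingEnd ℂ) (jostKernel k u) := by
  simp only [jostKernel, intervalIntegral]
  rw [map_sub, ← integral_conj, ← integral_conj]
  congr 1 <;>
  · congr 1
    ext s
    rw [← Complex.exp_conj]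
    congr 1
    simp [map_ofNat (starRingEnd ℂ) 2]

lemma jostIterate_neg_conj (Q : ℝ → ℝ) (k : ℂ) (n : ℕ) (y : ℝ) :
    jostIterate Q (-(starRingEnd ℂ) k) n y = (starRingEnd ℂ) (jostIterate Q k n y) := by
  induction n generalizing y with
  | zero => simp [jostIterate]
  | succ n ih =>
    simp only [jostIterate]
    rw [← integral_conj]
    congr 1
    ext s
    simp [ih, jostKernel_neg_conj]

lemma jostSeries_neg_conj (Q : ℝ → ℝ) (k : ℂ) (y : ℝ) :
    jostSeries Q (-(starRingEnd ℂ) k) y = (starRingEnd ℂ) (jostSeries Q k y) := by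
  simp only [jostSeries, jostIterate_neg_conj]
  exact (Complex.conj_tsum _).symm

lemma jostSlope_neg_conj (Q : ℝ → ℝ) (k : ℂ) (y : ℝ) :
    jostSlope Q (-(starRingEnd ℂ) k) y = (starRingEnd ℂ) (jostSlope Q k y) := by
  simp only [jostSlope]
  rw [← integral_conj]
  congr 1
  ext s
  rw [map_mul, map_mul, ← Complex.exp_conj, jostSeries_neg_conj]
  simp [map_ofNat (starRingEnd ℂ) 2]

end IsLinePotential

/-! ### Solutions of the Schrödinger equation -/

/-- `u` solves `u'' = (q - k²) u` on `[0,∞)` with `u'` as its derivative; both functions are locally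
absolutely continuous. -/
structure IsSolutionPair (q : ℝ → ℝ) (k : ℂ) (u u' : ℝ → ℂ) : Prop where
  isPrimitive : IsPrimitive u u' 0
  isPrimitive' : IsPrimitive u' (fun t => ((q t : ℂ) - k ^ 2) * u t) 0

namespace IsSolutionPair

variable {q : ℝ → ℝ} {k : ℂ} {u u' v v' : ℝ → ℂ}

lemma neg_param (h : IsSolutionPair q (-k) u u') : IsSolutionPair q k u u' where
  isPrimitive := h.isPrimitive
  isPrimitive' := by simpa using h.isPrimitive'

lemma const_mul (h : IsSolutionPair q k u u') (c : ℂ) :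
    IsSolutionPair q k (fun x => c * u x) (fun x => c * u' x) where
  isPrimitive := h.isPrimitive.const_mul c
  isPrimitive' := (h.isPrimitive'.const_mul c).congr (fun _ _ => rfl) (fun _ _ => by ring)

lemma sub (h : IsSolutionPair q k u u') (h' : IsSolutionPair q k v v') :
    IsSolutionPair q k (fun x => u x - v x) (fun x => u' x - v' x) where
  isPrimitive := h.isPrimitive.sub h'.isPrimitive
  isPrimitive' := (h.isPrimitive'.sub h'.isPrimitive').congr (fun _ _ => rfl) (fun _ _ => by ring)

lemma halfDeriv_eq (h : IsSolutionPair q k u u') {x : ℝ} (hx : 0 ≤ x) : halfDeriv u x = u' x :=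
  (h.isPrimitive.hasDerivWithinAt h.isPrimitive'.continuousOn hx).derivWithin
    (uniqueDiffOn_Ici 0 x hx)

lemma isSolution (h : IsSolutionPair q k u u') : IsSolution q k u where
  differentiableOn _ hx :=
    (h.isPrimitive.hasDerivWithinAt h.isPrimitive'.continuousOn hx).differentiableWithinAt
  halfDeriv_eq x hx := by
    rw [h.halfDeriv_eq hx, h.halfDeriv_eq le_rfl]
    exact h.isPrimitive'.eq_add x hx

/-- The Wronskian of two solutions is constant. -/
lemma wronskian_eq (h : IsSolutionPair q k u u') (h' : IsSolutionPair q k v v') {x : ℝ}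
    (hx : 0 ≤ x) : u x * v' x - u' x * v x = u 0 * v' 0 - u' 0 * v 0 := by
  have h1 := (h.isPrimitive.mul h'.isPrimitive').sub (h.isPrimitive'.mul h'.isPrimitive)
  have h2 : IsPrimitive (fun x => u x * v' x - u' x * v x) (fun _ => 0) 0 :=
    h1.congr (fun _ _ => rfl) (fun _ _ => by ring)
  exact h2.eq_of_zero hx

end IsSolutionPair

namespace MemL11

variable {q : ℝ → ℝ}

lemma integrableOn (hq : MemL11 q) : IntegrableOn q (Set.Ioi 0) := by
  have hm : AEStronglyMeasurable q (volume.restrict (Set.Ioi 0)) := by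
    have h1 : AEStronglyMeasurable (fun x : ℝ => (1 + x)⁻¹) (volume.restrict (Set.Ioi 0)) :=
      (by fun_prop : Measurable fun x : ℝ => (1 + x)⁻¹).aestronglyMeasurable
    refine (h1.mul (Integrable.aestronglyMeasurable hq)).congr ?_
    filter_upwards [ae_restrict_mem measurableSet_Ioi] with x hx
    have : (1 + x) ≠ 0 := by have : (0 : ℝ) < x := hx; positivity
    simp only [Pi.mul_apply]
    field_simp
  refine Integrable.mono' (Integrable.norm hq) hm ?_
  filter_upwards [ae_restrict_mem measurableSet_Ioi] with x hx
  have hx' : (0 : ℝ) < x := hx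
  rw [norm_mul, Real.norm_of_nonneg (by positivity : 0 ≤ 1 + x)]
  nlinarith [norm_nonneg (q x)]

lemma intervalIntegrable (hq : MemL11 q) {b : ℝ} (hb : 0 ≤ b) :
    IntervalIntegrable q volume 0 b := by
  rw [intervalIntegrable_iff, Set.uIoc_of_le hb]
  exact hq.integrableOn.mono_set Set.Ioc_subset_Ioi_self

lemma isSolutionPair (hq : MemL11 q) {k : ℂ} {u : ℝ → ℂ} (hu : IsSolution q k u) :
    IsSolutionPair q k u (halfDeriv u) := by
  have hprim : IsPrimitive (halfDeriv u) (fun t => ((q t : ℂ) - k ^ 2) * u t) 0 := by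
    refine ⟨fun b hb => ?_, fun b hb => hu.halfDeriv_eq b hb⟩
    refine IntervalIntegrable.mul_continuousOn ?_ (hu.differentiableOn.continuousOn.mono ?_)
    · exact IntervalIntegrable.sub (f := fun t => (q t : ℂ))
        ⟨(hq.intervalIntegrable hb).1.ofReal, (hq.intervalIntegrable hb).2.ofReal⟩
        intervalIntegrable_const
    · rw [Set.uIcc_of_le hb]
      exact Set.Icc_subset_Ici_self
  exact ⟨.of_hasDerivWithinAt (fun x hx => (hu.differentiableOn x hx).hasDerivWithinAt)
    hprim.continuousOn, hprim⟩

end MemL11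

/-! ### Jost solutions on the line -/

/-- The Jost solution at `+∞` of a potential on the line. -/
noncomputable def lineJost (Q : ℝ → ℝ) (k : ℂ) (y : ℝ) : ℂ :=
  Complex.exp (Complex.I * k * y) * jostSeries Q k y

/-- The derivative in `y` of `lineJost Q k y`. -/
noncomputable def lineJostDeriv (Q : ℝ → ℝ) (k : ℂ) (y : ℝ) : ℂ :=
  Complex.exp (Complex.I * k * y) * (Complex.I * k * jostSeries Q k y - jostSlope Q k y)

lemma isPrimitive_cexp (c : ℂ) (a : ℝ) :
    IsPrimitive (fun y : ℝ => Complex.exp (c * y)) (fun y : ℝ => c * Complex.exp (c * y)) a := by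
  refine .of_hasDerivAt (fun x => ?_) (by fun_prop)
  have h1 : HasDerivAt (fun y : ℝ => c * (y : ℂ)) c x := by
    simpa using (Complex.ofRealCLM.hasDerivAt (x := x)).const_mul c
  rw [mul_comm c]
  exact h1.cexp

namespace IsLinePotential

variable {Q : ℝ → ℝ} {k : ℂ}

lemma integrableOn_mul_jostSeries (hQ : IsLinePotential Q) (hk : IsAdmissible Q k) (a : ℝ) :
    IntegrableOn (fun s => Q s * jostSeries Q k s) (Set.Ioi a) := by
  have h1 := (hQ.integrable.abs.integrableOn (s := Set.Ioi a)).const_mul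
    (jostWeight k a * Real.exp (tailMoment Q a))
  refine Integrable.mono' h1 ?_ ?_
  · exact ((Complex.continuous_ofReal.comp_aestronglyMeasurable
      hQ.integrable.aestronglyMeasurable).mul (hQ.aestronglyMeasurable_jostSeries hk)).restrict
  · filter_upwards [ae_restrict_mem measurableSet_Ioi] with s hs
    have h2 := hQ.norm_jostSeries_le hk s
    have h3 := hQ.tailMoment_anti (le_of_lt hs)
    have h4 := jostWeight_anti k (le_of_lt hs)
    have h5 := (jostWeight_pos k a).le
    rw [norm_mul, Complex.norm_real, Real.norm_eq_abs, mul_comm]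
    gcongr
    exact h2.trans (by gcongr)

lemma isPrimitive_jostSlope (hQ : IsLinePotential Q) (hk : IsAdmissible Q k) (a : ℝ) :
    IsPrimitive (jostSlope Q k)
      (fun y => -(2 * Complex.I * k) * jostSlope Q k y - Q y * jostSeries Q k y) a := by
  have hsplit : ∀ y s : ℝ, Complex.exp (2 * Complex.I * k * (s - y : ℝ)) =
      Complex.exp (-(2 * Complex.I * k) * y) * Complex.exp (2 * Complex.I * k * s) := by
    intro y s
    rw [← Complex.exp_add]
    congr 1
    push_cast
    ring
  have hinv : ∀ y : ℝ, Complex.exp (-(2 * Complex.I * k) * y) * Complex.exp (2 * Complex.I * k * y)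
      = 1 := by
    intro y
    rw [← Complex.exp_add]
    simp
  have hint : IntegrableOn (fun s : ℝ => Complex.exp (2 * Complex.I * k * s) * Q s *
      jostSeries Q k s) (Set.Ioi a) := by
    refine ((hQ.integrableOn_cexp_mul hk a).const_mul
      (Complex.exp (2 * Complex.I * k * a))).congr (Eventually.of_forall fun s => ?_)
    simp only [hsplit]
    linear_combination (Complex.exp (2 * Complex.I * k * s) * Q s * jostSeries Q k s) * hinv a
  have hslope : ∀ y, jostSlope Q k y = Complex.exp (-(2 * Complex.I * k) * y) *
      ∫ s in Set.Ioi y, Complex.exp (2 * Complex.I * k * s) * Q s * jostSeries Q k s := by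
    intro y
    rw [jostSlope, ← integral_const_mul]
    congr 1
    ext s
    rw [hsplit]
    ring
  refine ((isPrimitive_cexp (-(2 * Complex.I * k)) a).mul (isPrimitive_integral_Ioi hint)).congr
    (fun y _ => hslope y) (fun y _ => ?_)
  rw [hslope y]
  linear_combination (Q y * jostSeries Q k y) * hinv y

lemma isPrimitive_jostSeries (hQ : IsLinePotential Q) (hk : IsAdmissible Q k) (hk0 : k ≠ 0)
    (a : ℝ) : IsPrimitive (jostSeries Q k) (fun y => -jostSlope Q k y) a := by
  have hc : 2 * Complex.I * k ≠ 0 := by simp [hk0]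
  have hint := hQ.integrableOn_mul_jostSeries hk
  have hrep : ∀ y, jostSeries Q k y = 1 + (2 * Complex.I * k)⁻¹ *
      (jostSlope Q k y - ∫ s in Set.Ioi y, Q s * jostSeries Q k s) := by
    intro y
    rw [hQ.jostSeries_eq hk y, jostSlope, ← integral_sub (hQ.integrableOn_cexp_mul hk y) (hint y),
      ← integral_const_mul]
    congr 2
    ext s
    rw [jostKernel_eq hk0]
    field_simp
  refine ((IsPrimitive.const 1).add (((hQ.isPrimitive_jostSlope hk a).sub
    (isPrimitive_integral_Ioi (hint a))).const_mul (2 * Complex.I * k)⁻¹)).congr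
    (fun y _ => hrep y) (fun y _ => ?_)
  field_simp
  ring

lemma isPrimitive_lineJost (hQ : IsLinePotential Q) (hk : IsAdmissible Q k) (hk0 : k ≠ 0)
    (a : ℝ) : IsPrimitive (lineJost Q k) (lineJostDeriv Q k) a := by
  refine ((isPrimitive_cexp (Complex.I * k) a).mul (hQ.isPrimitive_jostSeries hk hk0 a)).congr
    (fun y _ => rfl) (fun y _ => ?_)
  rw [lineJostDeriv]
  ring

lemma isPrimitive_lineJostDeriv (hQ : IsLinePotential Q) (hk : IsAdmissible Q k) (hk0 : k ≠ 0)
    (a : ℝ) : IsPrimitive (lineJostDeriv Q k)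
      (fun y => ((Q y : ℂ) - k ^ 2) * lineJost Q k y) a := by
  refine ((isPrimitive_cexp (Complex.I * k) a).mul
    (((hQ.isPrimitive_jostSeries hk hk0 a).const_mul (Complex.I * k)).sub
      (hQ.isPrimitive_jostSlope hk a))).congr (fun y _ => rfl) (fun y _ => ?_)
  rw [lineJost]
  linear_combination (-k ^ 2 * Complex.exp (Complex.I * k * y) * jostSeries Q k y) * Complex.I_sq

lemma jostSeries_zero (hQ : IsLinePotential Q) (h0 : ∀ s, 0 < s → Q s = 0) (k : ℂ) :
    jostSeries Q k 0 = 1 := by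
  rw [hQ.jostSeries_eq (Or.inr h0) 0, setIntegral_congr_fun measurableSet_Ioi
    (g := fun _ => 0) (fun s hs => by simp [h0 s hs])]
  simp

lemma jostSlope_zero (h0 : ∀ s, 0 < s → Q s = 0) (k : ℂ) :
    jostSlope Q k 0 = 0 := by
  rw [jostSlope, setIntegral_congr_fun measurableSet_Ioi
    (g := fun _ => 0) (fun s hs => by simp [h0 s hs])]
  simp

end IsLinePotential

/-! ### The two families of solutions on the half-line -/

/-- The potential extended by zero to the line. -/
noncomputable def extendZero (q : ℝ → ℝ) : ℝ → ℝ := (Set.Ioi 0).indicator q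

/-- The potential reflected to the negative half-line and extended by zero. -/
noncomputable def reflectZero (q : ℝ → ℝ) : ℝ → ℝ := (Set.Iio 0).indicator fun s => q (-s)

/-- The solution on `[0,∞)` with `u(0) = 1`, `u'(0) = -ik`. It is the Jost solution of the
reflected potential, read backwards, and hence is defined for every `k ∈ ℂ`. -/
noncomputable def incoming (q : ℝ → ℝ) (k : ℂ) (x : ℝ) : ℂ := lineJost (reflectZero q) k (-x)

/-- The derivative in `x` of `incoming q k x`. -/
noncomputable def incomingDeriv (q : ℝ → ℝ) (k : ℂ) (x : ℝ) : ℂ :=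
  -lineJostDeriv (reflectZero q) k (-x)

lemma reflectZero_of_pos (q : ℝ → ℝ) {s : ℝ} (hs : 0 < s) : reflectZero q s = 0 :=
  Set.indicator_of_notMem (by simp [hs.le]) _

namespace MemL11

variable {q : ℝ → ℝ} {k : ℂ}

lemma isLinePotential_extendZero (hq : MemL11 q) : IsLinePotential (extendZero q) where
  integrable := (integrable_indicator_iff measurableSet_Ioi).2 hq.integrableOn
  moment := by
    have h : IntegrableOn (fun x => (1 + x) * q x - q x) (Set.Ioi 0) :=
      Integrable.sub hq hq.integrableOn
    refine h.congr_fun (fun x hx => ?_) measurableSet_Ioi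
    simp only [extendZero, Set.indicator_of_mem hx]
    ring

lemma isLinePotential_reflectZero (hq : MemL11 q) : IsLinePotential (reflectZero q) where
  integrable := by
    have h := ((integrable_indicator_iff measurableSet_Ioi).2 hq.integrableOn).comp_neg
    refine h.congr (Eventually.of_forall fun x => ?_)
    by_cases hx : x < 0
    · simp [reflectZero, Set.indicator, hx]
    · simp [reflectZero, Set.indicator, hx]
  moment := by
    have h : IntegrableOn (fun _ : ℝ => (0 : ℝ)) (Set.Ioi 0) := integrableOn_zero
    refine h.congr_fun (fun x hx => ?_) measurableSet_Ioi
    simp [reflectZero_of_pos q hx]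

lemma isSolutionPair_lineJost (hq : MemL11 q) (hk : 0 ≤ k.im) (hk0 : k ≠ 0) :
    IsSolutionPair q k (lineJost (extendZero q) k)
      (lineJostDeriv (extendZero q) k) where
  isPrimitive := hq.isLinePotential_extendZero.isPrimitive_lineJost (Or.inl hk) hk0 0
  isPrimitive' := (hq.isLinePotential_extendZero.isPrimitive_lineJostDeriv (Or.inl hk) hk0 0).congr
    (fun _ _ => rfl) fun x hx => by
      rw [extendZero, Set.indicator_of_mem (show x ∈ Set.Ioi 0 from hx)]

lemma isSolutionPair_incoming (hq : MemL11 q) (hk0 : k ≠ 0) :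
    IsSolutionPair q k (incoming q k) (incomingDeriv q k) where
  isPrimitive := IsPrimitive.reflect fun a =>
    hq.isLinePotential_reflectZero.isPrimitive_lineJost (Or.inr fun _ => reflectZero_of_pos q) hk0 a
  isPrimitive' := ((IsPrimitive.reflect (a := 0) fun a =>
    hq.isLinePotential_reflectZero.isPrimitive_lineJostDeriv (Or.inr fun _ => reflectZero_of_pos q)
      hk0 a).const_mul (-1)).congr (fun x _ => by rw [incomingDeriv]; ring) fun x hx => by
      rw [incoming, reflectZero, Set.indicator_of_mem (show -x ∈ Set.Iio 0 by simpa using hx),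
        neg_neg]
      ring

lemma incoming_zero (hq : MemL11 q) (k : ℂ) : incoming q k 0 = 1 := by
  rw [incoming, neg_zero, lineJost,
    hq.isLinePotential_reflectZero.jostSeries_zero fun _ => reflectZero_of_pos q]
  simp

lemma incomingDeriv_zero (hq : MemL11 q) (k : ℂ) : incomingDeriv q k 0 = -(Complex.I * k) := by
  rw [incomingDeriv, neg_zero, lineJostDeriv,
    hq.isLinePotential_reflectZero.jostSeries_zero fun _ => reflectZero_of_pos q,
    IsLinePotential.jostSlope_zero fun _ => reflectZero_of_pos q]
  simp

lemma wronskian_incoming (hq : MemL11 q) (hk0 : k ≠ 0) {x : ℝ} (hx : 0 ≤ x) :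
    incoming q k x * incomingDeriv q (-k) x - incomingDeriv q k x * incoming q (-k) x =
      2 * Complex.I * k := by
  rw [(hq.isSolutionPair_incoming hk0).wronskian_eq
    (hq.isSolutionPair_incoming (neg_ne_zero.2 hk0)).neg_param hx]
  simp only [hq.incoming_zero, hq.incomingDeriv_zero]
  ring

/-- Uniqueness for the initial value problem, from the fundamental system `incoming q (±k)`. -/
lemma eq_zero_of_initial (hq : MemL11 q) (hk0 : k ≠ 0) {u u' : ℝ → ℂ}
    (h : IsSolutionPair q k u u') (h0 : u 0 = 0) (h0' : u' 0 = 0) {x : ℝ} (hx : 0 ≤ x) :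
    u x = 0 := by
  have w := hq.wronskian_incoming hk0 hx
  have w1 := h.wronskian_eq (hq.isSolutionPair_incoming hk0) hx
  have w2 := h.wronskian_eq (hq.isSolutionPair_incoming (neg_ne_zero.2 hk0)).neg_param hx
  rw [h0, h0', zero_mul, zero_mul, sub_zero] at w1 w2
  have hc : 2 * Complex.I * k ≠ 0 := by simp [hk0]
  have : u x * (2 * Complex.I * k) = 0 := by
    rw [← w]
    linear_combination incoming q k x * w2 - incoming q (-k) x * w1
  exact (mul_eq_zero.1 this).resolve_right hc

end MemL11

/-! ### The Jost solution on the half-line -/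

/-- A bounded function whose derivative has a limit at infinity has derivative tending to `0`. -/
lemma IsPrimitive.eq_zero_of_tendsto {U u : ℝ → ℂ} {c : ℂ} {B : ℝ} (h : IsPrimitive U u 0)
    (hu : Tendsto u atTop (𝓝 c)) (hB : ∀ᶠ x in atTop, ‖U x‖ ≤ B) : c = 0 := by
  by_contra hc
  have hc' : 0 < ‖c‖ := norm_pos_iff.2 hc
  obtain ⟨a, ha⟩ := eventually_atTop.1 ((Metric.tendsto_nhds.1 hu (‖c‖ / 2) (by positivity)).and
    ((eventually_ge_atTop 0).and hB))
  have ha0 := (ha a le_rfl).2.1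
  set x : ℝ := a + (2 * B + 1) / (‖c‖ / 2) with hx
  have hB0 : 0 ≤ B := (norm_nonneg _).trans (ha a le_rfl).2.2
  have hax : a ≤ x := by
    rw [hx]
    have : 0 ≤ (2 * B + 1) / (‖c‖ / 2) := by positivity
    linarith
  have hsub := h.sub_eq ha0 (ha0.trans hax)
  have h1 : ‖(∫ t in a..x, u t) - (x - a : ℝ) * c‖ ≤ ‖c‖ / 2 * (x - a) := by
    have h2 : (∫ t in a..x, u t) - (x - a : ℝ) * c = ∫ t in a..x, (u t - c) := by
      rw [intervalIntegral.integral_sub (h.intervalIntegrable' ha0 (ha0.trans hax))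
        intervalIntegrable_const, intervalIntegral.integral_const, Complex.real_smul]
    rw [h2, ← abs_of_nonneg (sub_nonneg.2 hax)]
    refine intervalIntegral.norm_integral_le_of_norm_le_const fun t ht => ?_
    rw [Set.uIoc_of_le hax] at ht
    rw [← dist_eq_norm]
    exact (ha t ht.1.le).1.le
  have h3 : ‖(∫ t in a..x, u t)‖ ≤ 2 * B := by
    rw [← hsub]
    refine (norm_sub_le _ _).trans ?_
    linarith [(ha a le_rfl).2.2, (ha x hax).2.2]
  have h4 : ‖((x - a : ℝ) : ℂ) * c‖ = (x - a) * ‖c‖ := by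
    rw [norm_mul, Complex.norm_real, Real.norm_of_nonneg (sub_nonneg.2 hax)]
  have h5 : ‖((x - a : ℝ) : ℂ) * c‖ ≤ ‖(∫ t in a..x, u t)‖ +
      ‖(∫ t in a..x, u t) - (x - a : ℝ) * c‖ := by
    have := norm_sub_norm_le (((x - a : ℝ) : ℂ) * c) (∫ t in a..x, u t)
    rw [norm_sub_rev] at this
    linarith
  have h6 : (x - a) * (‖c‖ / 2) = 2 * B + 1 := by
    rw [hx, add_sub_cancel_left, div_mul_cancel₀ _ (by positivity)]
  rw [h4] at h5
  linarith

/-- If `U' = g - w` with `U` and `g` integrable on `(0,∞)` and `w` constant, then `w = 0`. -/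
lemma IsPrimitive.eq_zero_of_integrable {U g : ℝ → ℂ} {w : ℂ}
    (h : IsPrimitive U (fun x => g x - w) 0) (hg : IntegrableOn g (Set.Ioi 0))
    (hU : IntegrableOn U (Set.Ioi 0)) : w = 0 := by
  by_contra hw
  have hw' : 0 < ‖w‖ := norm_pos_iff.2 hw
  set C : ℝ := ‖U 0‖ + ∫ t in Set.Ioi 0, ‖g t‖ with hC
  have hbound : ∀ x, 0 ≤ x → ‖w‖ * x - C ≤ ‖U x‖ := by
    intro x hx
    have hgx : IntervalIntegrable g volume 0 x := by
      rw [intervalIntegrable_iff, Set.uIoc_of_le hx]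
      exact hg.mono_set Set.Ioc_subset_Ioi_self
    have h1 := h.eq_add x hx
    rw [intervalIntegral.integral_sub hgx intervalIntegrable_const,
      intervalIntegral.integral_const, Complex.real_smul, sub_zero] at h1
    have h2 : ‖∫ t in (0 : ℝ)..x, g t‖ ≤ ∫ t in Set.Ioi 0, ‖g t‖ := by
      refine (intervalIntegral.norm_integral_le_integral_norm hx).trans ?_
      rw [intervalIntegral.integral_of_le hx]
      exact setIntegral_mono_set hg.norm (Eventually.of_forall fun _ => norm_nonneg _)
        Set.Ioc_subset_Ioi_self.eventuallyLE
    have h3 : (x : ℂ) * w = U 0 + (∫ t in (0 : ℝ)..x, g t) - U x := by rw [h1]; ring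
    have h4 : ‖(x : ℂ) * w‖ = ‖w‖ * x := by
      rw [norm_mul, Complex.norm_real, Real.norm_of_nonneg hx, mul_comm]
    have h5 := norm_sub_le (U 0 + ∫ t in (0 : ℝ)..x, g t) (U x)
    have h6 := norm_add_le (U 0) (∫ t in (0 : ℝ)..x, g t)
    rw [← h3, h4] at h5
    linarith
  have hC0 : 0 ≤ C := add_nonneg (norm_nonneg _) (integral_nonneg fun _ => norm_nonneg _)
  set X : ℝ := (C + 1) / ‖w‖ with hX
  have hX0 : 0 ≤ X := by positivity
  have hone : IntegrableOn (fun _ : ℝ => (1 : ℝ)) (Set.Ioi X) := by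
    refine Integrable.mono' (hU.mono_set (Set.Ioi_subset_Ioi hX0)).norm
      aestronglyMeasurable_const ?_
    filter_upwards [ae_restrict_mem measurableSet_Ioi] with x hx
    have hx' : X < x := hx
    have h1 := hbound x (hX0.trans hx'.le)
    have h2 : C + 1 ≤ ‖w‖ * x := by
      have := (div_le_iff₀ hw').1 hx'.le
      linarith
    rw [norm_one]
    linarith
  rw [integrableOn_const_iff] at hone
  simp at hone

lemma cexp_neg_mul_lineJost (Q : ℝ → ℝ) (k : ℂ) (x : ℝ) :
    Complex.exp (-(Complex.I * k * x)) * lineJost Q k x = jostSeries Q k x := by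
  rw [lineJost, ← mul_assoc, ← Complex.exp_add]
  simp

lemma cexp_neg_mul_lineJostDeriv (Q : ℝ → ℝ) (k : ℂ) (x : ℝ) :
    Complex.exp (-(Complex.I * k * x)) * lineJostDeriv Q k x =
      Complex.I * k * jostSeries Q k x - jostSlope Q k x := by
  rw [lineJostDeriv, ← mul_assoc, ← Complex.exp_add]
  simp

lemma tendsto_cexp_neg_mul_lineJostDeriv {Q : ℝ → ℝ} {k : ℂ} (hQ : IsLinePotential Q)
    (hk : 0 ≤ k.im) :
    Tendsto (fun x : ℝ => Complex.exp (-(Complex.I * k * x)) * lineJostDeriv Q k x) atTop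
      (𝓝 (Complex.I * k)) := by
  simp_rw [cexp_neg_mul_lineJostDeriv]
  simpa using ((hQ.tendsto_jostSeries hk).const_mul (Complex.I * k)).sub (hQ.tendsto_jostSlope hk)

lemma norm_cexp_I_mul (k : ℂ) (x : ℝ) :
    ‖Complex.exp (Complex.I * k * x)‖ = Real.exp (-(k.im * x)) := by
  rw [Complex.norm_exp]
  congr 1
  simp

namespace MemL11

variable {q : ℝ → ℝ} {k : ℂ}

lemma isJostSolution (hq : MemL11 q) (hk : 0 ≤ k.im) (hk0 : k ≠ 0) :
    IsJostSolution q k (lineJost (extendZero q) k) where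
  isSolution := (hq.isSolutionPair_lineJost hk hk0).isSolution
  asymptotics := by
    simp_rw [cexp_neg_mul_lineJost]
    exact hq.isLinePotential_extendZero.tendsto_jostSeries hk

/-- Uniqueness of the Jost solution. The product `d f` of the difference `d` of two Jost solutions
and the Jost solution `f` is bounded, and its derivative `2 d f' - w` tends to minus the Wronskian
`w` of `d` and `f`. Hence `w = 0`, so `d` is proportional to `f`, and `d = o(f)` gives `d = 0`. -/
lemma eq_lineJost (hq : MemL11 q) (hk : 0 ≤ k.im) (hk0 : k ≠ 0) {v : ℝ → ℂ}
    (hv : IsJostSolution q k v) {x : ℝ} (hx : 0 ≤ x) :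
    v x = lineJost (extendZero q) k x := by
  set f := lineJost (extendZero q) k with hf
  set f' := lineJostDeriv (extendZero q) k with hf'
  have pf : IsSolutionPair q k f f' := hq.isSolutionPair_lineJost hk hk0
  set d : ℝ → ℂ := fun x => v x - f x with hd
  set d' : ℝ → ℂ := fun x => halfDeriv v x - f' x with hd'
  have pd : IsSolutionPair q k d d' := (hq.isSolutionPair hv.isSolution).sub pf
  set e : ℝ → ℂ := fun x => Complex.exp (-(Complex.I * k * x)) with he
  have lf : Tendsto (fun x => e x * f x) atTop (𝓝 1) := (hq.isJostSolution hk hk0).asymptotics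
  have lf' : Tendsto (fun x => e x * f' x) atTop (𝓝 (Complex.I * k)) :=
    tendsto_cexp_neg_mul_lineJostDeriv hq.isLinePotential_extendZero hk
  have ld : Tendsto (fun x => e x * d x) atTop (𝓝 0) := by
    have := hv.asymptotics.sub lf
    rw [sub_self] at this
    exact this.congr fun x => by simp only [hd, he]; ring
  have hee : ∀ x : ℝ, Complex.exp (2 * Complex.I * k * x) * (e x * e x) = 1 := by
    intro x
    rw [he, ← Complex.exp_add, ← Complex.exp_add]
    ring_nf
    simp
  have hprod : ∀ {g h : ℝ → ℂ} {c : ℂ}, Tendsto (fun x => e x * g x) atTop (𝓝 0) →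
      Tendsto (fun x => e x * h x) atTop (𝓝 c) → Tendsto (fun x => g x * h x) atTop (𝓝 0) := by
    intro g h c hg hh
    have h1 := hg.mul hh
    rw [zero_mul] at h1
    refine squeeze_zero_norm' ?_ (tendsto_zero_iff_norm_tendsto_zero.1 h1)
    filter_upwards [eventually_ge_atTop 0] with x hx
    have h2 : ‖Complex.exp (2 * Complex.I * k * x)‖ ≤ 1 := by
      rw [norm_cexp_two_I_mul]
      exact Real.exp_le_one_iff.2 (by have := mul_nonneg hk hx; linarith)
    have h3 : g x * h x =
        Complex.exp (2 * Complex.I * k * x) * ((e x * g x) * (e x * h x)) := by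
      linear_combination (-(g x * h x)) * hee x
    rw [h3, norm_mul]
    exact mul_le_of_le_one_left (norm_nonneg _) h2
  set w : ℂ := d 0 * f' 0 - d' 0 * f 0 with hw
  have hw0 : w = 0 := by
    have h1 : IsPrimitive (fun x => d x * f x) (fun x => d' x * f x + d x * f' x) 0 :=
      pd.isPrimitive.mul pf.isPrimitive
    have h2 : Tendsto (fun x => d' x * f x + d x * f' x) atTop (𝓝 (-w)) := by
      have h3 : Tendsto (fun x => 2 * (d x * f' x) - w) atTop (𝓝 (2 * 0 - w)) :=
        ((hprod ld lf').const_mul 2).sub_const w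
      rw [mul_zero, zero_sub] at h3
      refine h3.congr' ?_
      filter_upwards [eventually_ge_atTop 0] with x hx
      rw [hw, ← pd.wronskian_eq pf hx]
      ring
    have h3 := (hprod ld lf).norm.eventually_le_const (u := 1) (by simp)
    exact neg_eq_zero.1 (h1.eq_zero_of_tendsto h2 h3)
  -- a multiple `c d = c' f` forces `c' = 0`
  have hprop : ∀ c c' : ℂ, c * d 0 - c' * f 0 = 0 → c * d' 0 - c' * f' 0 = 0 → c' = 0 := by
    intro c c' h0 h0'
    have h1 : Tendsto (fun x => c * (e x * d x) - c' * (e x * f x)) atTop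
        (𝓝 (c * 0 - c' * 1)) := (ld.const_mul c).sub (lf.const_mul c')
    have h2 : Tendsto (fun x => c * (e x * d x) - c' * (e x * f x)) atTop (𝓝 0) := by
      refine tendsto_const_nhds.congr' ?_
      filter_upwards [eventually_ge_atTop 0] with x hx
      have := hq.eq_zero_of_initial hk0 ((pd.const_mul c).sub (pf.const_mul c')) h0 h0' hx
      linear_combination (-e x) * this
    simpa using tendsto_nhds_unique h1 h2
  have hd0 : d 0 = 0 := hprop (f 0) (d 0) (by ring) (by rw [← neg_eq_zero, ← hw0]; ring)
  have hd0' : d' 0 = 0 := hprop (f' 0) (d' 0) (by rw [← hw0]; ring) (by ring)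
  exact sub_eq_zero.1 (hq.eq_zero_of_initial hk0 pd hd0 hd0' hx)

lemma isJostSolution_jostSolution (hq : MemL11 q) (hk : 0 ≤ k.im) (hk0 : k ≠ 0) :
    IsJostSolution q k (jostSolution q k) := by
  have h : ∃ u : ℝ → ℂ, IsJostSolution q k u := ⟨_, hq.isJostSolution hk hk0⟩
  rw [jostSolution, dif_pos h]
  exact h.choose_spec

lemma jostSolution_eq (hq : MemL11 q) (hk : 0 ≤ k.im) (hk0 : k ≠ 0) {x : ℝ} (hx : 0 ≤ x) :
    jostSolution q k x = lineJost (extendZero q) k x :=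
  hq.eq_lineJost hk hk0 (hq.isJostSolution_jostSolution hk hk0) hx

lemma jostFunction_eq (hq : MemL11 q) (hk : 0 ≤ k.im) (hk0 : k ≠ 0) :
    jostFunction q k = lineJost (extendZero q) k 0 := hq.jostSolution_eq hk hk0 le_rfl

lemma iFunction_eq (hq : MemL11 q) (hk : 0 ≤ k.im) (hk0 : k ≠ 0) :
    iFunction q k =
      lineJostDeriv (extendZero q) k 0 / lineJost (extendZero q) k 0 := by
  rw [iFunction, hq.jostFunction_eq hk hk0,
    ← (hq.isSolutionPair_lineJost hk hk0).halfDeriv_eq le_rfl]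
  congr 1
  exact derivWithin_congr (fun x hx => hq.jostSolution_eq hk hk0 hx)
    (hq.jostSolution_eq hk hk0 le_rfl)

/-- The Jost function has no real zeros apart from `k = 0`: the Jost solutions for `k` and `-k` are
complex conjugate and their Wronskian is `-2ik`. -/
lemma lineJost_zero_ne_zero (hq : MemL11 q) {k : ℝ} (hk0 : k ≠ 0) :
    lineJost (extendZero q) k 0 ≠ 0 := by
  intro h0
  set Q := extendZero q
  have hkc : (k : ℂ) ≠ 0 := Complex.ofReal_ne_zero.2 hk0
  have hneg : lineJost Q (-k) 0 = 0 := by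
    have h1 := IsLinePotential.jostSeries_neg_conj Q (k : ℂ) 0
    rw [Complex.conj_ofReal] at h1
    simp only [lineJost, Complex.ofReal_zero, mul_zero, Complex.exp_zero, one_mul] at h0 ⊢
    rw [h1, h0, map_zero]
  have p1 := hq.isSolutionPair_lineJost (k := (k : ℂ)) (by simp) hkc
  have p2 := (hq.isSolutionPair_lineJost (k := -(k : ℂ)) (by simp) (neg_ne_zero.2 hkc)).neg_param
  have hw : ∀ x : ℝ, 0 ≤ x → lineJost Q k x * lineJostDeriv Q (-k) x -
      lineJostDeriv Q k x * lineJost Q (-k) x = 0 := by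
    intro x hx
    rw [p1.wronskian_eq p2 hx, h0, hneg]
    ring
  have hlim : Tendsto (fun x => lineJost Q k x * lineJostDeriv Q (-k) x -
      lineJostDeriv Q k x * lineJost Q (-k) x) atTop (𝓝 (1 * (Complex.I * (-k)) -
        (Complex.I * k) * 1)) := by
    have hQ : IsLinePotential Q := hq.isLinePotential_extendZero
    refine (((hQ.tendsto_jostSeries (k := (k : ℂ)) (by simp)).mul
      (tendsto_cexp_neg_mul_lineJostDeriv hQ (k := -(k : ℂ)) (by simp))).sub
      ((tendsto_cexp_neg_mul_lineJostDeriv hQ (k := (k : ℂ)) (by simp)).mul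
      (hQ.tendsto_jostSeries (k := -(k : ℂ)) (by simp)))).congr fun x => ?_
    rw [← cexp_neg_mul_lineJost, ← cexp_neg_mul_lineJost]
    have h1 : Complex.exp (-(Complex.I * k * x)) * Complex.exp (-(Complex.I * -k * x)) = 1 := by
      rw [← Complex.exp_add]
      simp
    linear_combination (lineJost Q k x * lineJostDeriv Q (-k) x -
      lineJostDeriv Q k x * lineJost Q (-k) x) * h1
  have := tendsto_nhds_unique (hlim.congr' (by
    filter_upwards [eventually_ge_atTop 0] with x hx using hw x hx)) tendsto_const_nhds
  have h2 : (2 * Complex.I * k : ℂ) = 0 := by linear_combination -this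
  simp [hk0] at h2

/-! ### The Weyl solution -/

lemma memLp_two_of_norm_le_exp {g : ℝ → ℂ} {C b : ℝ} (hb : 0 < b)
    (hg : ContinuousOn g (Set.Ici 0)) (hC : ∀ x, 0 ≤ x → ‖g x‖ ≤ C * Real.exp (-(b * x))) :
    MemLp g 2 (volume.restrict (Set.Ioi 0)) := by
  have hm : AEStronglyMeasurable g (volume.restrict (Set.Ioi 0)) :=
    (hg.mono Set.Ioi_subset_Ici_self).aestronglyMeasurable measurableSet_Ioi
  refine (memLp_two_iff_integrable_sq_norm hm).2 ?_
  refine Integrable.mono' ((exp_neg_integrableOn_Ioi 0 (by positivity : 0 < 2 * b)).const_mul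
    (C ^ 2)) (hm.norm.pow 2) ?_
  filter_upwards [ae_restrict_mem measurableSet_Ioi] with x hx
  rw [Real.norm_of_nonneg (by positivity)]
  calc ‖g x‖ ^ 2 ≤ (C * Real.exp (-(b * x))) ^ 2 :=
        pow_le_pow_left₀ (norm_nonneg _) (hC x (le_of_lt hx)) 2
    _ = C ^ 2 * Real.exp (-(2 * b) * x) := by
        rw [mul_pow, ← Real.exp_nat_mul]
        congr 2
        push_cast
        ring

lemma norm_jostSeries_le_const (hq : MemL11 q) (hk : 0 ≤ k.im) {x : ℝ} (hx : 0 ≤ x) :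
    ‖jostSeries (extendZero q) k x‖ ≤ Real.exp (tailMoment (extendZero q) 0) := by
  have := hq.isLinePotential_extendZero.norm_jostSeries_le (Or.inl hk) x
  rw [jostWeight_of_im_nonneg hk, one_mul] at this
  exact this.trans (Real.exp_le_exp.2 (hq.isLinePotential_extendZero.tailMoment_anti hx))

lemma norm_jostSlope_le_const (hq : MemL11 q) (hk : 0 ≤ k.im) {x : ℝ} (hx : 0 ≤ x) :
    ‖jostSlope (extendZero q) k x‖ ≤ Real.exp (tailMoment (extendZero q) 0) *
      ∫ s in Set.Ioi 0, |extendZero q s| := by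
  have h := hq.isLinePotential_extendZero.norm_jostSlope_le (Or.inl hk) x
  rw [jostWeight_of_im_nonneg hk, one_mul] at h
  refine h.trans (mul_le_mul
    (Real.exp_le_exp.2 (hq.isLinePotential_extendZero.tailMoment_anti hx)) ?_
    (integral_nonneg fun _ => abs_nonneg _) (Real.exp_pos _).le)
  exact antitone_integral_Ioi hq.isLinePotential_extendZero.integrable.abs
    (fun _ => abs_nonneg _) hx

lemma norm_lineJost_le (hq : MemL11 q) (hk : 0 ≤ k.im) {x : ℝ} (hx : 0 ≤ x) :
    ‖lineJost (extendZero q) k x‖ ≤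
      Real.exp (tailMoment (extendZero q) 0) * Real.exp (-(k.im * x)) := by
  rw [lineJost, norm_mul, norm_cexp_I_mul, mul_comm]
  exact mul_le_mul_of_nonneg_right (hq.norm_jostSeries_le_const hk hx) (Real.exp_pos _).le

lemma memLp_lineJost (hq : MemL11 q) (hk : 0 < k.im) :
    MemLp (lineJost (extendZero q) k) 2 (volume.restrict (Set.Ioi 0)) := by
  have hk0 : k ≠ 0 := by rintro rfl; simp at hk
  exact memLp_two_of_norm_le_exp hk
    (hq.isSolutionPair_lineJost hk.le hk0).isPrimitive.continuousOn
    fun x hx => hq.norm_lineJost_le hk.le hx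

lemma memLp_lineJostDeriv (hq : MemL11 q) (hk : 0 < k.im) :
    MemLp (lineJostDeriv (extendZero q) k) 2 (volume.restrict (Set.Ioi 0)) := by
  have hk0 : k ≠ 0 := by rintro rfl; simp at hk
  refine memLp_two_of_norm_le_exp (C := ‖k‖ * Real.exp (tailMoment (extendZero q) 0) +
      Real.exp (tailMoment (extendZero q) 0) *
        ∫ s in Set.Ioi 0, |extendZero q s|) hk
    (hq.isSolutionPair_lineJost hk.le hk0).isPrimitive'.continuousOn fun x hx => ?_
  rw [lineJostDeriv, norm_mul, norm_cexp_I_mul, mul_comm]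
  refine mul_le_mul_of_nonneg_right ((norm_sub_le _ _).trans (add_le_add ?_
    (hq.norm_jostSlope_le_const hk.le hx))) (Real.exp_pos _).le
  rw [norm_mul, norm_mul, Complex.norm_I, one_mul]
  exact mul_le_mul_of_nonneg_left (hq.norm_jostSeries_le_const hk.le hx) (norm_nonneg _)

/-- The Jost solution spans the square integrable solutions. If `W` is square integrable and `w` is
its Wronskian with the Jost solution `f`, then `(W f)' = 2 W f' - w`, where `W f` and `W f'` are
integrable; hence `w = 0`. -/
lemma isWeylValue_iff (hq : MemL11 q) (hk : 0 < k.im) (hf0 : jostFunction q k ≠ 0) (m : ℂ) :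
    IsWeylValue q k m ↔ m = iFunction q k := by
  have hk0 : k ≠ 0 := by rintro rfl; simp at hk
  rw [hq.jostFunction_eq hk.le hk0] at hf0
  rw [hq.iFunction_eq hk.le hk0]
  set f := lineJost (extendZero q) k with hf
  set f' := lineJostDeriv (extendZero q) k with hf'
  have pf : IsSolutionPair q k f f' := hq.isSolutionPair_lineJost hk.le hk0
  constructor
  · rintro ⟨W, hW, hW0, hWm, hWL⟩
    have pW := hq.isSolutionPair hW
    have h1 : IsPrimitive (fun x => W x * f x)
        (fun x => 2 * (W x * f' x) - (f' 0 - m * f 0)) 0 := by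
      refine (pW.isPrimitive.mul pf.isPrimitive).congr (fun _ _ => rfl) fun x hx => ?_
      have := pW.wronskian_eq pf hx.le
      rw [hW0, hWm] at this
      linear_combination this
    have h2 : IntegrableOn (fun x => W x * f' x) (Set.Ioi 0) :=
      hWL.integrable_mul (hq.memLp_lineJostDeriv hk)
    have h3 : IntegrableOn (fun x => W x * f x) (Set.Ioi 0) :=
      hWL.integrable_mul (hq.memLp_lineJost hk)
    have h4 := h1.eq_zero_of_integrable (h2.const_mul 2) h3
    rw [eq_div_iff hf0]
    linear_combination -h4
  · rintro rfl
    have pW := pf.const_mul (f 0)⁻¹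
    refine ⟨_, pW.isSolution, inv_mul_cancel₀ hf0, ?_, (hq.memLp_lineJost hk).const_mul _⟩
    rw [pW.halfDeriv_eq le_rfl, div_eq_inv_mul]

end MemL11

/-! ### Coincidence of the I-functions in the upper half-plane -/

/-- Phragmén–Lindelöf in the upper half-plane for functions of exponential type that are bounded
along the imaginary axis. -/
lemma norm_le_of_upper_half_plane {f : ℂ → ℂ} {A B C : ℝ}
    (hd : DifferentiableOn ℂ f {k | 0 < k.im}) (hc : ContinuousOn f {k | 0 ≤ k.im})
    (hexp : ∀ k : ℂ, 0 ≤ k.im → ‖f k‖ ≤ A * Real.exp (B * ‖k‖))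
    (him : IsBoundedUnder (· ≤ ·) atTop fun t : ℝ => ‖f (Complex.I * t)‖)
    (hre : ∀ x : ℝ, ‖f x‖ ≤ C) {k : ℂ} (hk : 0 ≤ k.im) : ‖f k‖ ≤ C := by
  have hrot : ∀ z : ℂ, (Complex.I * z).im = z.re := fun z => by simp
  have hdc : DiffContOnCl ℂ (fun z => f (Complex.I * z)) {z | 0 < z.re} := by
    refine ⟨hd.comp (by fun_prop) fun z hz => ?_, ?_⟩
    · change 0 < (Complex.I * z).im
      rw [hrot]; exact hz
    · rw [Complex.closure_setOfPred_lt_re]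
      refine hc.comp (by fun_prop) fun z hz => ?_
      change 0 ≤ (Complex.I * z).im
      rw [hrot]; exact hz
  have key := PhragmenLindelof.right_half_plane_of_bounded_on_real (C := C) (z := -Complex.I * k)
    hdc ⟨1, by norm_num, B, ?_⟩ him (fun x => ?_) (by simpa using hk)
  · have : Complex.I * (-Complex.I * k) = k := by linear_combination (-k) * Complex.I_sq
    simpa only [this] using key
  · refine Asymptotics.IsBigO.of_bound A ?_
    refine eventually_inf_principal.2 (Eventually.of_forall fun z hz => ?_)
    have h1 := hexp (Complex.I * z) (by rw [hrot]; exact le_of_lt hz)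
    rw [norm_mul, Complex.norm_I, one_mul] at h1
    rwa [Real.rpow_one, Real.norm_of_nonneg (Real.exp_pos _).le]
  · have : Complex.I * (x * Complex.I) = ((-x : ℝ) : ℂ) := by
      push_cast
      linear_combination (x : ℂ) * Complex.I_sq
    rw [this]
    exact hre _

/-- The Wronskian `f₁' f₂ - f₁ f₂'` at `x = 0` of the Jost solutions of two potentials. The terms
`ik f₁ f₂` cancel, so that it is bounded in `k`. -/
noncomputable def crossJost (q₁ q₂ : ℝ → ℝ) (k : ℂ) : ℂ :=
  jostSeries (extendZero q₁) k 0 * jostSlope (extendZero q₂) k 0 -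
    jostSlope (extendZero q₁) k 0 * jostSeries (extendZero q₂) k 0

lemma crossJost_neg_conj (q₁ q₂ : ℝ → ℝ) (k : ℂ) :
    crossJost q₁ q₂ (-(starRingEnd ℂ) k) = (starRingEnd ℂ) (crossJost q₁ q₂ k) := by
  simp only [crossJost, IsLinePotential.jostSeries_neg_conj, IsLinePotential.jostSlope_neg_conj,
    map_sub, map_mul]

namespace IsLinePotential

variable {Q : ℝ → ℝ}

lemma continuousOn_jostSeries_upper (hQ : IsLinePotential Q) (y : ℝ) :
    ContinuousOn (fun k => jostSeries Q k y) {k | 0 ≤ k.im} :=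
  continuousOn_upper fun ρ => hQ.continuousOn_jostSeries (ρ := ρ) (fun _ hk => Or.inl hk.1)
    (fun _ hk => (mem_ball_zero_iff.1 hk.2).le) y

lemma continuousOn_jostSlope_upper (hQ : IsLinePotential Q) (y : ℝ) :
    ContinuousOn (fun k => jostSlope Q k y) {k | 0 ≤ k.im} :=
  continuousOn_upper fun ρ => hQ.continuousOn_jostSlope (ρ := ρ) (fun _ hk => Or.inl hk.1)
    (fun _ hk => (mem_ball_zero_iff.1 hk.2).le) y

lemma differentiableOn_jostSeries_upper (hQ : IsLinePotential Q) (y : ℝ) :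
    DifferentiableOn ℂ (fun k => jostSeries Q k y) {k | 0 < k.im} :=
  differentiableOn_upper fun ρ => hQ.differentiableOn_jostSeries (ρ := ρ)
    (fun _ hk => Or.inl (le_of_lt hk.1)) (fun _ hk => (mem_ball_zero_iff.1 hk.2).le)
    (isOpen_upper_inter_ball ρ) y

lemma differentiableOn_jostSlope_upper (hQ : IsLinePotential Q) (y : ℝ) :
    DifferentiableOn ℂ (fun k => jostSlope Q k y) {k | 0 < k.im} :=
  differentiableOn_upper fun ρ => hQ.differentiableOn_jostSlope (ρ := ρ)
    (fun _ hk => Or.inl (le_of_lt hk.1)) (fun _ hk => (mem_ball_zero_iff.1 hk.2).le)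
    (isOpen_upper_inter_ball ρ) y

end IsLinePotential

lemma crossJost_eq_zero {q₁ q₂ : ℝ → ℝ} (h₁ : MemL11 q₁) (h₂ : MemL11 q₂)
    (h : ∀ k : ℝ, 0 < k → iFunction q₁ (k : ℂ) = iFunction q₂ (k : ℂ)) {k : ℂ}
    (hk : 0 ≤ k.im) : crossJost q₁ q₂ k = 0 := by
  have hcont : ContinuousOn (crossJost q₁ q₂) {k | 0 ≤ k.im} :=
    ((h₁.isLinePotential_extendZero.continuousOn_jostSeries_upper 0).mul
      (h₂.isLinePotential_extendZero.continuousOn_jostSlope_upper 0)).sub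
      ((h₁.isLinePotential_extendZero.continuousOn_jostSlope_upper 0).mul
      (h₂.isLinePotential_extendZero.continuousOn_jostSeries_upper 0))
  have hdiff : DifferentiableOn ℂ (crossJost q₁ q₂) {k | 0 < k.im} :=
    ((h₁.isLinePotential_extendZero.differentiableOn_jostSeries_upper 0).mul
      (h₂.isLinePotential_extendZero.differentiableOn_jostSlope_upper 0)).sub
      ((h₁.isLinePotential_extendZero.differentiableOn_jostSlope_upper 0).mul
      (h₂.isLinePotential_extendZero.differentiableOn_jostSeries_upper 0))
  have hpos : ∀ x : ℝ, 0 < x → crossJost q₁ q₂ x = 0 := by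
    intro x hx
    have hx0 : (x : ℂ) ≠ 0 := Complex.ofReal_ne_zero.2 hx.ne'
    have e := h x hx
    rw [h₁.iFunction_eq (by simp) hx0, h₂.iFunction_eq (by simp) hx0,
      div_eq_div_iff (h₁.lineJost_zero_ne_zero hx.ne') (h₂.lineJost_zero_ne_zero hx.ne')] at e
    simp only [lineJost, lineJostDeriv, Complex.ofReal_zero, mul_zero, Complex.exp_zero,
      one_mul] at e
    rw [crossJost]
    linear_combination e
  have hreal : ∀ x : ℝ, crossJost q₁ q₂ x = 0 := by
    intro x
    rcases lt_trichotomy x 0 with hx | hx | hx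
    · have h1 := crossJost_neg_conj q₁ q₂ ((-x : ℝ) : ℂ)
      rw [hpos _ (by linarith), Complex.conj_ofReal] at h1
      simpa using h1
    · subst hx
      have hc : ContinuousWithinAt (fun t : ℝ => crossJost q₁ q₂ t) (Set.Ioi 0) 0 := by
        have h1 := hcont.comp (f := fun t : ℝ => (t : ℂ)) (s := Set.univ)
          Complex.continuous_ofReal.continuousOn (fun t _ => by simp)
        exact (h1 0 (Set.mem_univ _)).mono (Set.subset_univ _)
      refine tendsto_nhds_unique hc (tendsto_const_nhds.congr' ?_)
      filter_upwards [self_mem_nhdsWithin] with t ht using (hpos t ht).symm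
    · exact hpos x hx
  obtain ⟨C, hC⟩ : ∃ C, ∀ k : ℂ, 0 ≤ k.im → ‖crossJost q₁ q₂ k‖ ≤ C := by
    refine ⟨_, fun k hk => le_trans (norm_sub_le _ _) (add_le_add
      (le_trans (norm_mul_le _ _) (mul_le_mul (h₁.norm_jostSeries_le_const hk le_rfl)
        (h₂.norm_jostSlope_le_const hk le_rfl) (norm_nonneg _) (Real.exp_pos _).le))
      (le_trans (norm_mul_le _ _) (mul_le_mul (h₁.norm_jostSlope_le_const hk le_rfl)
        (h₂.norm_jostSeries_le_const hk le_rfl) (norm_nonneg _)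
        ((norm_nonneg _).trans (h₁.norm_jostSlope_le_const hk le_rfl)))))⟩
  have hz := norm_le_of_upper_half_plane (f := crossJost q₁ q₂) (A := C) (B := 0) (C := 0)
    hdiff hcont (fun k hk => by simpa using hC k hk)
    (isBoundedUnder_of_eventually_le (a := C) (by
      filter_upwards [eventually_ge_atTop 0] with t ht
      exact hC _ (by simpa using ht)))
    (fun x => by simp [hreal x]) hk
  exact norm_le_zero_iff.1 hz

/-! ### Coincidence of the regular solutions -/

/-- The function `e₁(-k) e₂(k) - e₁(k) e₂(-k)` at the point `x`, where `eⱼ(k)` is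
`incoming qⱼ k`. -/
noncomputable def crossIncoming (q₁ q₂ : ℝ → ℝ) (x : ℝ) (k : ℂ) : ℂ :=
  incoming q₁ (-k) x * incoming q₂ k x - incoming q₁ k x * incoming q₂ (-k) x

lemma crossIncoming_neg (q₁ q₂ : ℝ → ℝ) (x : ℝ) (k : ℂ) :
    crossIncoming q₁ q₂ x (-k) = -crossIncoming q₁ q₂ x k := by
  rw [crossIncoming, crossIncoming, neg_neg]
  ring

namespace MemL11

variable {q : ℝ → ℝ} {k : ℂ}

lemma differentiable_incoming (hq : MemL11 q) (x : ℝ) :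
    Differentiable ℂ fun k => incoming q k x := by
  unfold incoming lineJost
  exact Differentiable.mul (by fun_prop)
    (hq.isLinePotential_reflectZero.differentiable_jostSeries (fun _ => reflectZero_of_pos q) _)

lemma norm_incoming_le (hq : MemL11 q) (k : ℂ) {x : ℝ} (hx : 0 ≤ x) :
    ‖incoming q k x‖ ≤
      Real.exp (tailMoment (reflectZero q) (-x)) * Real.exp (|k.im| * x) := by
  have h := hq.isLinePotential_reflectZero.norm_jostSeries_le (k := k)
    (Or.inr fun _ => reflectZero_of_pos q) (-x)
  rw [incoming, lineJost, norm_mul, norm_cexp_I_mul]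
  refine (mul_le_mul_of_nonneg_left h (Real.exp_pos _).le).trans (le_of_eq ?_)
  rw [jostWeight, neg_neg, max_eq_left hx, ← mul_assoc, ← Real.exp_add, mul_comm]
  congr 2
  rcases le_total 0 k.im with h0 | h0
  · rw [abs_of_nonneg h0, max_eq_right (by linarith)]
    ring
  · rw [abs_of_nonpos h0, max_eq_left (by linarith)]
    ring

/-- The Jost solution in terms of the fundamental system `incoming q (±k)`. -/
lemma lineJost_eq_incoming (hq : MemL11 q) (hk : 0 ≤ k.im) (hk0 : k ≠ 0) {x : ℝ} (hx : 0 ≤ x) :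
    2 * Complex.I * k * lineJost (extendZero q) k x =
      (2 * Complex.I * k * jostSeries (extendZero q) k 0 -
        jostSlope (extendZero q) k 0) * incoming q (-k) x +
      jostSlope (extendZero q) k 0 * incoming q k x := by
  set h := jostSeries (extendZero q) k 0 with hh
  set p := jostSlope (extendZero q) k 0 with hp
  have pe := hq.isSolutionPair_incoming hk0
  have pe' := (hq.isSolutionPair_incoming (neg_ne_zero.2 hk0)).neg_param
  have pd := (((hq.isSolutionPair_lineJost hk hk0).const_mul (2 * Complex.I * k)).sub
    (pe'.const_mul (2 * Complex.I * k * h - p))).sub (pe.const_mul p)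
  have hf : lineJost (extendZero q) k 0 = h := by simp [lineJost, hh]
  have hf' : lineJostDeriv (extendZero q) k 0 = Complex.I * k * h - p := by
    simp [lineJostDeriv, hh, hp]
  have hz := hq.eq_zero_of_initial hk0 pd
    (by rw [hf, hq.incoming_zero, hq.incoming_zero]; ring)
    (by rw [hf', hq.incomingDeriv_zero, hq.incomingDeriv_zero]; ring) hx
  linear_combination hz

/-- The coefficient of `incoming q (-k)` in `2ik` times the Jost solution is of exact order `k` at
infinity in the upper half-plane. -/
lemma eventually_norm_coeff (hq : MemL11 q) :
    ∀ᶠ t : ℝ in atTop, ∀ k : ℂ, 0 ≤ k.im → ‖k‖ = t →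
      t ≤ ‖2 * Complex.I * k * jostSeries (extendZero q) k 0 -
        jostSlope (extendZero q) k 0‖ ∧
      ‖2 * Complex.I * k * jostSeries (extendZero q) k 0 -
        jostSlope (extendZero q) k 0‖ ≤ 3 * t := by
  set C : ℝ := Real.exp (tailMoment (extendZero q) 0) *
    ∫ s in Set.Ioi 0, |extendZero q s| with hC
  filter_upwards [eventually_ge_atTop (3 * C), eventually_gt_atTop 0] with t ht ht0 k hk hkt
  have hk0 : k ≠ 0 := norm_pos_iff.1 (hkt ▸ ht0)
  set h := jostSeries (extendZero q) k 0
  set p := jostSlope (extendZero q) k 0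
  have h1 : ‖2 * Complex.I * k * (h - 1)‖ ≤ 2 * C := by
    have h2 := hq.isLinePotential_extendZero.norm_jostSeries_sub_one_le_div hk hk0 0
    rw [← hC, le_div_iff₀ (hkt ▸ ht0)] at h2
    rw [norm_mul, norm_mul, norm_mul, Complex.norm_I, Complex.norm_ofNat]
    linarith
  have h2 : ‖p‖ ≤ C := hq.norm_jostSlope_le_const hk le_rfl
  have h3 : ‖2 * Complex.I * k‖ = 2 * t := by simp [hkt]
  have h4 : ‖2 * Complex.I * k * (h - 1) - p‖ ≤ 3 * C := (norm_sub_le _ _).trans (by linarith)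
  have e1 : 2 * Complex.I * k * h - p = 2 * Complex.I * k + (2 * Complex.I * k * (h - 1) - p) := by
    ring
  have h5 := norm_add_le (2 * Complex.I * k) (2 * Complex.I * k * (h - 1) - p)
  have h6 := norm_sub_norm_le (2 * Complex.I * k) (-(2 * Complex.I * k * (h - 1) - p))
  rw [norm_neg, sub_neg_eq_add] at h6
  rw [e1]
  constructor <;> linarith

end MemL11

/-- Along the positive imaginary axis the growth of `incoming` is compensated by the decay of the
Jost solution: when the Jost solutions have proportional initial data, `crossIncoming` is a
combination of products of an `incoming` and a Jost solution. -/
lemma isBoundedUnder_crossIncoming {q₁ q₂ : ℝ → ℝ} (h₁ : MemL11 q₁) (h₂ : MemL11 q₂)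
    (h : ∀ k : ℂ, 0 ≤ k.im → crossJost q₁ q₂ k = 0) {x : ℝ} (hx : 0 ≤ x) :
    IsBoundedUnder (· ≤ ·) atTop fun t : ℝ => ‖crossIncoming q₁ q₂ x (Complex.I * t)‖ := by
  set A₁ := Real.exp (tailMoment (extendZero q₁) 0)
  set A₂ := Real.exp (tailMoment (extendZero q₂) 0)
  set B₁ := Real.exp (tailMoment (reflectZero q₁) (-x))
  set B₂ := Real.exp (tailMoment (reflectZero q₂) (-x))
  refine isBoundedUnder_of_eventually_le (a := 6 * (A₁ * B₂ + A₂ * B₁)) ?_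
  filter_upwards [h₁.eventually_norm_coeff, h₂.eventually_norm_coeff, eventually_gt_atTop 0]
    with t ht₁ ht₂ ht
  set k : ℂ := Complex.I * t with hkdef
  have hkim : k.im = t := by simp [hkdef]
  have hknorm : ‖k‖ = t := by simp [hkdef, abs_of_pos ht]
  have hk : 0 ≤ k.im := by rw [hkim]; exact ht.le
  have hk0 : k ≠ 0 := norm_pos_iff.1 (hknorm ▸ ht)
  obtain ⟨l₁, u₁⟩ := ht₁ k hk hknorm
  obtain ⟨l₂, u₂⟩ := ht₂ k hk hknorm
  have d₁ := h₁.lineJost_eq_incoming hk hk0 hx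
  have d₂ := h₂.lineJost_eq_incoming hk hk0 hx
  have f₁ := h₁.norm_lineJost_le hk hx
  have f₂ := h₂.norm_lineJost_le hk hx
  have e₁ := h₁.norm_incoming_le k hx
  have e₂ := h₂.norm_incoming_le k hx
  rw [hkim] at f₁ f₂
  rw [hkim, abs_of_pos ht] at e₁ e₂
  have hD := h k hk
  rw [crossJost] at hD
  set a₁ := 2 * Complex.I * k * jostSeries (extendZero q₁) k 0 - jostSlope (extendZero q₁) k 0
    with ha₁
  set a₂ := 2 * Complex.I * k * jostSeries (extendZero q₂) k 0 - jostSlope (extendZero q₂) k 0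
    with ha₂
  have hab : a₁ * jostSlope (extendZero q₂) k 0 - a₂ * jostSlope (extendZero q₁) k 0 = 0 := by
    rw [ha₁, ha₂]
    linear_combination 2 * Complex.I * k * hD
  have key : a₁ * a₂ * crossIncoming q₁ q₂ x k = 2 * Complex.I * k *
      (a₂ * (lineJost (extendZero q₁) k x * incoming q₂ k x) -
        a₁ * (lineJost (extendZero q₂) k x * incoming q₁ k x)) := by
    rw [crossIncoming]
    linear_combination -a₂ * incoming q₂ k x * d₁ + a₁ * incoming q₁ k x * d₂ +
      incoming q₁ k x * incoming q₂ k x * hab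
  have hexp : Real.exp (-(t * x)) * Real.exp (t * x) = 1 := by
    rw [← Real.exp_add]; simp
  have m₁ : ‖lineJost (extendZero q₁) k x * incoming q₂ k x‖ ≤ A₁ * B₂ := by
    rw [norm_mul]
    calc _ ≤ (A₁ * Real.exp (-(t * x))) * (B₂ * Real.exp (t * x)) :=
          mul_le_mul f₁ e₂ (norm_nonneg _) (by positivity)
      _ = A₁ * B₂ * (Real.exp (-(t * x)) * Real.exp (t * x)) := by ring
      _ = _ := by rw [hexp, mul_one]
  have m₂ : ‖lineJost (extendZero q₂) k x * incoming q₁ k x‖ ≤ A₂ * B₁ := by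
    rw [norm_mul]
    calc _ ≤ (A₂ * Real.exp (-(t * x))) * (B₁ * Real.exp (t * x)) :=
          mul_le_mul f₂ e₁ (norm_nonneg _) (by positivity)
      _ = A₂ * B₁ * (Real.exp (-(t * x)) * Real.exp (t * x)) := by ring
      _ = _ := by rw [hexp, mul_one]
  have up : ‖a₁ * a₂ * crossIncoming q₁ q₂ x k‖ ≤
      t ^ 2 * (6 * (A₁ * B₂ + A₂ * B₁)) := by
    rw [key, norm_mul, show ‖2 * Complex.I * k‖ = 2 * t by simp [hknorm]]
    calc _ ≤ 2 * t * (3 * t * (A₁ * B₂) + 3 * t * (A₂ * B₁)) := by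
          refine mul_le_mul_of_nonneg_left ((norm_sub_le _ _).trans ?_) (by positivity)
          rw [norm_mul a₂, norm_mul a₁]
          gcongr
      _ = _ := by ring
  have lo : t ^ 2 * ‖crossIncoming q₁ q₂ x k‖ ≤ ‖a₁ * a₂ * crossIncoming q₁ q₂ x k‖ := by
    rw [norm_mul, norm_mul, sq]
    gcongr
  exact le_of_mul_le_mul_left (lo.trans up) (by positivity)

lemma crossIncoming_eq_zero {q₁ q₂ : ℝ → ℝ} (h₁ : MemL11 q₁) (h₂ : MemL11 q₂)
    (h : ∀ k : ℂ, 0 ≤ k.im → crossJost q₁ q₂ k = 0) {x : ℝ} (hx : 0 ≤ x) (k : ℂ) :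
    crossIncoming q₁ q₂ x k = 0 := by
  set B₁ := Real.exp (tailMoment (reflectZero q₁) (-x)) with hB₁
  set B₂ := Real.exp (tailMoment (reflectZero q₂) (-x)) with hB₂
  have hdiff : Differentiable ℂ (crossIncoming q₁ q₂ x) := by
    have d₁ := h₁.differentiable_incoming x
    have d₂ := h₂.differentiable_incoming x
    exact ((d₁.comp differentiable_neg).mul d₂).sub (d₁.mul (d₂.comp differentiable_neg))
  have hgrowth : ∀ k : ℂ, ‖crossIncoming q₁ q₂ x k‖ ≤
      2 * (B₁ * B₂) * Real.exp (2 * |k.im| * x) := by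
    intro k
    have e₁ := h₁.norm_incoming_le k hx
    have e₂ := h₂.norm_incoming_le k hx
    have e₁' := h₁.norm_incoming_le (-k) hx
    have e₂' := h₂.norm_incoming_le (-k) hx
    rw [Complex.neg_im, abs_neg] at e₁' e₂'
    have hE : Real.exp (2 * |k.im| * x) = Real.exp (|k.im| * x) * Real.exp (|k.im| * x) := by
      rw [← Real.exp_add]; ring_nf
    refine (norm_sub_le _ _).trans ?_
    rw [norm_mul, norm_mul, hE]
    have m₁ := mul_le_mul e₁' e₂ (norm_nonneg _) (by positivity)
    have m₂ := mul_le_mul e₁ e₂' (norm_nonneg _) (by positivity)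
    rw [hB₁, hB₂]
    linarith
  have hupper : ∀ k : ℂ, 0 ≤ k.im → ‖crossIncoming q₁ q₂ x k‖ ≤ 2 * (B₁ * B₂) := by
    intro k hk
    refine norm_le_of_upper_half_plane (A := 2 * (B₁ * B₂)) (B := 2 * x)
      hdiff.differentiableOn hdiff.continuous.continuousOn (fun k _ => (hgrowth k).trans ?_)
      (isBoundedUnder_crossIncoming h₁ h₂ h hx) (fun y => by simpa using hgrowth y) hk
    have := Complex.abs_im_le_norm k
    refine mul_le_mul_of_nonneg_left (Real.exp_le_exp.2 ?_) (by positivity)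
    nlinarith
  have hbdd : Bornology.IsBounded (Set.range (crossIncoming q₁ q₂ x)) := by
    refine (isBounded_iff_forall_norm_le).2 ⟨2 * (B₁ * B₂), ?_⟩
    rintro _ ⟨k, rfl⟩
    rcases le_total 0 k.im with hk | hk
    · exact hupper k hk
    · have := hupper (-k) (by simpa using hk)
      rwa [crossIncoming_neg, norm_neg] at this
  rw [hdiff.apply_eq_apply_of_bounded hbdd k 0, crossIncoming, neg_zero]
  ring

/-! ### Recovery of the potential -/

lemma incoming_neg_real (q : ℝ → ℝ) (k x : ℝ) :
    incoming q (-(k : ℂ)) x = (starRingEnd ℂ) (incoming q k x) := by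
  have h := IsLinePotential.jostSeries_neg_conj (reflectZero q) (k : ℂ) (-x)
  rw [Complex.conj_ofReal] at h
  rw [incoming, incoming, lineJost, lineJost, map_mul, ← h, ← Complex.exp_conj]
  simp

lemma MemL11.incoming_real_ne_zero {q : ℝ → ℝ} (hq : MemL11 q) {k x : ℝ} (hk : k ≠ 0)
    (hx : 0 ≤ x) : incoming q k x ≠ 0 := by
  intro h0
  have hw := hq.wronskian_incoming (k := (k : ℂ)) (Complex.ofReal_ne_zero.2 hk) hx
  rw [incoming_neg_real, h0] at hw
  simp [hk] at hw

lemma IsPrimitive.ae_eq_zero {g : ℝ → ℂ} (h : IsPrimitive (fun _ => 0) g 0) :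
    ∀ᵐ x ∂(volume.restrict (Set.Ioi (0 : ℝ))), g x = 0 := by
  rw [ae_restrict_iff' measurableSet_Ioi]
  have hn : ∀ n : ℕ, ∀ᵐ x, x ∈ Set.uIcc (0 : ℝ) n → ∀ c ∈ Set.uIcc (0 : ℝ) n,
      HasDerivAt (fun x => ∫ t in c..x, g t) (g x) x := fun n =>
    (h.intervalIntegrable n n.cast_nonneg).ae_hasDerivAt_integral
  filter_upwards [ae_all_iff.2 hn] with x hx hx0
  obtain ⟨n, hxn⟩ := exists_nat_gt x
  have hx0' : (0 : ℝ) < x := hx0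
  have hd := hx n (by rw [Set.uIcc_of_le n.cast_nonneg]; exact ⟨hx0'.le, hxn.le⟩) 0
    Set.left_mem_uIcc
  refine hd.unique ((hasDerivAt_const x (0 : ℂ)).congr_of_eventuallyEq ?_)
  filter_upwards [lt_mem_nhds hx0'] with y hy
  simpa using (h.eq_add y hy.le).symm

/-- If `e₁(-1) e₂(1) = e₁(1) e₂(-1)`, then differentiating and using that both Wronskians are equal
gives `e₁(1)² = e₂(1)²`; as `e₂(1)` has no zeros, `e₁(1) = e₂(1)`. -/
lemma incoming_eq_of_crossIncoming {q₁ q₂ : ℝ → ℝ} (h₁ : MemL11 q₁) (h₂ : MemL11 q₂)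
    (h : ∀ x : ℝ, 0 ≤ x → crossIncoming q₁ q₂ x 1 = 0) :
    Set.EqOn (incoming q₁ 1) (incoming q₂ 1) (Set.Ici 0) := by
  have p₁ := h₁.isSolutionPair_incoming (k := 1) one_ne_zero
  have p₂ := h₂.isSolutionPair_incoming (k := 1) one_ne_zero
  have n₁ := (h₁.isSolutionPair_incoming (k := -1) (neg_ne_zero.2 one_ne_zero)).neg_param
  have n₂ := (h₂.isSolutionPair_incoming (k := -1) (neg_ne_zero.2 one_ne_zero)).neg_param
  have hd : ∀ {q : ℝ → ℝ} {u u' : ℝ → ℂ}, IsSolutionPair q 1 u u' → ∀ {x : ℝ}, 0 ≤ x →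
      HasDerivWithinAt u (u' x) (Set.Ici 0) x := fun p _ hx =>
    p.isPrimitive.hasDerivWithinAt p.isPrimitive'.continuousOn hx
  refine isPreconnected_Ici.eq_of_sq_eq p₁.isPrimitive.continuousOn p₂.isPrimitive.continuousOn
    (fun x hx => ?_) (fun {x} hx => ?_) Set.self_mem_Ici
    (by rw [h₁.incoming_zero, h₂.incoming_zero])
  · have hA : incoming q₁ (-1) x * incoming q₂ 1 x - incoming q₁ 1 x * incoming q₂ (-1) x = 0 :=
      h x hx
    have hB : incomingDeriv q₁ (-1) x * incoming q₂ 1 x + incoming q₁ (-1) x * incomingDeriv q₂ 1 x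
        - (incomingDeriv q₁ 1 x * incoming q₂ (-1) x + incoming q₁ 1 x * incomingDeriv q₂ (-1) x)
        = 0 := by
      have d := ((hd n₁ hx).mul (hd p₂ hx)).sub ((hd p₁ hx).mul (hd n₂ hx))
      have d0 : HasDerivWithinAt (incoming q₁ (-1) * incoming q₂ 1 -
          incoming q₁ 1 * incoming q₂ (-1)) 0 (Set.Ici 0) x :=
        (hasDerivWithinAt_const x (Set.Ici 0) (0 : ℂ)).congr (fun y hy => h y hy) (h x hx)
      exact (uniqueDiffOn_Ici (0 : ℝ) x hx).eq_deriv _ d d0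
    have w₁ := h₁.wronskian_incoming (k := 1) one_ne_zero hx
    have w₂ := h₂.wronskian_incoming (k := 1) one_ne_zero hx
    have : 2 * Complex.I * (incoming q₁ 1 x ^ 2 - incoming q₂ 1 x ^ 2) = 0 := by
      linear_combination (-(incoming q₁ 1 x * incoming q₂ 1 x)) * hB +
        incoming q₂ 1 x ^ 2 * w₁ - incoming q₁ 1 x ^ 2 * w₂ +
        (incoming q₁ 1 x * incomingDeriv q₂ 1 x + incoming q₂ 1 x * incomingDeriv q₁ 1 x) * hA
    have h2I : 2 * Complex.I ≠ 0 := by simp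
    exact sub_eq_zero.1 ((mul_eq_zero.1 this).resolve_left h2I)
  · simpa using h₂.incoming_real_ne_zero (k := 1) one_ne_zero hx

lemma ae_eq_of_incoming_eq {q₁ q₂ : ℝ → ℝ} (h₁ : MemL11 q₁) (h₂ : MemL11 q₂)
    (h : Set.EqOn (incoming q₁ 1) (incoming q₂ 1) (Set.Ici 0)) :
    q₁ =ᵐ[volume.restrict (Set.Ioi 0)] q₂ := by
  have p₁ := h₁.isSolutionPair_incoming (k := 1) one_ne_zero
  have p₂ := h₂.isSolutionPair_incoming (k := 1) one_ne_zero
  have h' : ∀ x, 0 ≤ x → incomingDeriv q₁ 1 x = incomingDeriv q₂ 1 x := by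
    intro x hx
    rw [← p₁.halfDeriv_eq hx, ← p₂.halfDeriv_eq hx]
    exact derivWithin_congr h (h hx)
  have hz : IsPrimitive (fun _ => 0)
      (fun x => ((q₁ x : ℂ) - q₂ x) * incoming q₂ 1 x) 0 := by
    refine (p₁.isPrimitive'.sub p₂.isPrimitive').congr (fun x hx => ?_) fun x hx => ?_
    · rw [h' x hx, sub_self]
    · rw [h (le_of_lt hx : (0 : ℝ) ≤ x)]
      ring
  filter_upwards [hz.ae_eq_zero, ae_restrict_mem measurableSet_Ioi] with x hx hx0
  have hne : incoming q₂ 1 x ≠ 0 := by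
    simpa using h₂.incoming_real_ne_zero (k := 1) one_ne_zero (le_of_lt hx0)
  have := sub_eq_zero.1 ((mul_eq_zero.1 hx).resolve_right hne)
  exact_mod_cast this

theorem theorem2p1 :
    (∀ q : ℝ → ℝ, MemL11 q → ∀ k : ℂ, 0 < k.im → jostFunction q k ≠ 0 →
      ∀ m : ℂ, IsWeylValue q k m ↔ m = iFunction q k) ∧
    (∀ q₁ q₂ : ℝ → ℝ, MemL11 q₁ → MemL11 q₂ →
      (∀ k : ℝ, 0 < k → iFunction q₁ (k : ℂ) = iFunction q₂ (k : ℂ)) →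
      q₁ =ᵐ[volume.restrict (Set.Ioi 0)] q₂) :=
  ⟨fun _ hq _ hk hf m => hq.isWeylValue_iff hk hf m, fun _ _ h₁ h₂ h =>
    ae_eq_of_incoming_eq h₁ h₂ (incoming_eq_of_crossIncoming h₁ h₂ fun _ hx =>
      crossIncoming_eq_zero h₁ h₂ (fun _ hk => crossJost_eq_zero h₁ h₂ h hk) hx 1)⟩
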